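/- Let $\mathbb{H}$ be a real Hilbert space with a symplectic structure $\omega$, i.e. a continuous skew-symmetric bilinear form such that $\Omega:\mathbb{H}\to\mathbb{H}^*$, $\langle\Omega x,y\rangle=\omega(x,y)$, is an isomorphism. Let $\omega^*(\xi,\eta)=\omega(\Omega^{-1}\xi,\Omega^{-1}\eta)$ be the dual symplectic form on $\mathbb{H}^*$ and, for an absolutely continuous closed curve $\xi:\mathbb{T}=\mathbb{R}/\mathbb{Z}\to\mathbb{H}^*$, let $\mathbb{A}^*(\xi)=\frac12\int_{\mathbb{T}}\omega^*(\xi(t),\dot\xi(t))\,dt=\frac12\int_{\mathbb{T}}\langle \xi(t),\Omega^{-1}\dot\xi(t)\rangle\,dt$ be its action. Let $\mathscr{C}$ be the set of bounded closed convex neighborhoods of the origin in $\mathbb{H}$. For $C\in\mathscr{C}$ let $C^0=\{\xi\in\mathbb{H}^* : \langle\xi,x\rangle\le 1\ \forall x\in C\}$ be its polar, and define the symplectic capacity $$c_{\mathbb{H}}(C)=\frac{1}{4a_\infty(C)},\qquad a_\infty(C)=\sup\{\mathbb{A}^*(\xi) : \xi:\mathbb{T}\to\mathbb{H}^*\text{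 absolutely continuous},\ \dot\xi\in C^0\text{ a.e.}\}.$$ Let $\mu_C$ be the Minkowski gauge of $C$, $\mu_{C^0}$ that of $C^0$, and put $H_C=\frac12\mu_C^2$ on $\mathbb{H}$ and $H_{C^0}=\frac12\mu_{C^0}^2$ on $\mathbb{H}^*$. Let $\widehat{\mathscr{C}}$ be the set of those $C\in\mathscr{C}$ for which $H_C$ and $H_{C^0}$ are continuously differentiable and $dH_C$ and $dH_{C^0}$ are globally Lipschitz continuous. **Theorem.** Let $\psi:\mathbb{H}\setminus\{0\}\to\mathbb{H}\setminus\{0\}$ be a $C^1$ symplectomorphism (a $C^1$ diffeomorphism, with $C^1$ inverse, such that $\psi^*\omega=\omega$) which is positively 1-homogeneous, $\psi(tx)=t\psi(x)$ for all $x\neq0$ and $t>0$, extended continuously to the origin by $\psi(0)=0$. Assume that $d\psi$ and $d\psi^{-1}$ are bounded on $\mathbb{H}\setminus\{0\}$, and let $C\subset\mathbb{H}$ be such that both $C$ and $\psi(C)$ belong to $\widehat{\mathscr{C}}$. Then $$c_{\mathbb{H}}(\psi(C))=c_{\mathbb{H}}(C).$$ -/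

import Mathlib

open Topology

/-- A (strong) symplectic structure on a real Hilbert space: a skew-symmetric continuous bilinear
form `ω` which is non-degenerate in the sense that the associated bounded operator
`Ω : H → H*`, `⟨Ω x, y⟩ = ω(x, y)`, is an isomorphism. It is given by `Ω`, since `ω` and `Ω` are
the same data. -/
structure SymplecticStructure (H : Type*) [NormedAddCommGroup H] [InnerProductSpace ℝ H] where
  /-- The isomorphism `Ω : H → H*` associated with the form. -/
  Omega : H ≃L[ℝ] StrongDual ℝ H
  skew : ∀ x y : H, Omega x y = -Omega y x

namespace SymplecticStructure

variable {H : Type*} [NormedAddCommGroup H] [InnerProductSpace ℝ H]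

/-- The symplectic form `ω(x, y) = ⟨Ω x, y⟩`. -/
noncomputable def form (S : SymplecticStructure H) (x y : H) : ℝ := S.Omega x y

/-- The dual symplectic form `ω*(ξ, η) = ω(Ω⁻¹ ξ, Ω⁻¹ η)` on `H*`. -/
noncomputable def dualForm (S : SymplecticStructure H) (ξ η : StrongDual ℝ H) : ℝ :=
  S.form (S.Omega.symm ξ) (S.Omega.symm η)

/-- The action `𝔸*(ξ) = ∫_𝕋 ξ* λ*` of a closed curve in `H*`, where
`λ*(ξ)[η] = ω*(ξ, η) / 2` is the Liouville form of `(H*, ω*)`. A curve on `𝕋 = ℝ/ℤ` is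
represented by a `1`-periodic function on `ℝ`. -/
noncomputable def dualAction (S : SymplecticStructure H) (ξ : ℝ → StrongDual ℝ H) : ℝ :=
  ∫ t in (0 : ℝ)..1, (1 / 2) * S.dualForm (ξ t) (deriv ξ t)

end SymplecticStructure

section Convex

variable {H : Type*} [NormedAddCommGroup H] [InnerProductSpace ℝ H]

/-- The polar set `C⁰ = {ξ ∈ H* | ⟨ξ, x⟩ ≤ 1 for all x ∈ C}` (one-sided: no absolute value). -/
def polarSet (C : Set H) : Set (StrongDual ℝ H) := {ξ | ∀ x ∈ C, ξ x ≤ 1}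

/-- Absolutely continuous closed curves `ξ : 𝕋 → H*` whose derivative lies in the polar of `C`
almost everywhere. -/
structure IsPolarLoop (C : Set H) (ξ : ℝ → StrongDual ℝ H) : Prop where
  periodic : Function.Periodic ξ 1
  absolutelyContinuous : AbsolutelyContinuousOnInterval ξ 0 1
  deriv_mem : ∀ᵐ t : ℝ, DifferentiableAt ℝ ξ t ∧ deriv ξ t ∈ polarSet C

/-- `a_∞(C) = sup 𝔸*(ξ)` over all absolutely continuous loops `ξ` in `H*` with `ξ' ∈ C⁰` a.e.
For a neighbourhood `C` of the origin the set of actions is non-empty and bounded. -/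
noncomputable def aInfty (S : SymplecticStructure H) (C : Set H) : ℝ :=
  sSup {a : ℝ | ∃ ξ : ℝ → StrongDual ℝ H, IsPolarLoop C ξ ∧ S.dualAction ξ = a}

/-- The symplectic capacity `c_H(C) = 1 / (4 a_∞(C))`. -/
noncomputable def symplecticCapacity (S : SymplecticStructure H) (C : Set H) : ℝ :=
  1 / (4 * aInfty S C)

/-- The class `𝒞` of bounded closed convex neighbourhoods of the origin. -/
structure IsConvexNhd (C : Set H) : Prop where
  isBounded : Bornology.IsBounded C
  isClosed : IsClosed C
  convex : Convex ℝ C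
  mem_nhds : C ∈ 𝓝 (0 : H)

/-- Half of the square of the Minkowski gauge of `C`. -/
noncomputable def gaugeHamiltonian {E : Type*} [AddCommGroup E] [Module ℝ E]
    (C : Set E) (x : E) : ℝ :=
  (1 / 2) * gauge C x ^ 2

/-- The class `𝒞̂` of those `C ∈ 𝒞` for which `H_C` and `H_{C⁰}` are continuously differentiable,
with globally Lipschitz differentials. -/
structure IsRegularConvexNhd (C : Set H) : Prop extends IsConvexNhd C where
  contDiff : ContDiff ℝ 1 (gaugeHamiltonian C)
  lipschitz : ∃ K, LipschitzWith K (fderiv ℝ (gaugeHamiltonian C))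
  contDiff_polar : ContDiff ℝ 1 (gaugeHamiltonian (polarSet C))
  lipschitz_polar : ∃ K, LipschitzWith K (fderiv ℝ (gaugeHamiltonian (polarSet C)))

/-- Homogeneous `C¹` symplectomorphisms `ψ` of `H ∖ {0}` (diffeomorphisms of `H ∖ {0}` which are
`C¹` with their inverse, preserve the symplectic form and are positively `1`-homogeneous), extended
to the origin by `ψ 0 = 0`. -/
structure IsHomogeneousSymplectomorphism (S : SymplecticStructure H) (ψ : H ≃ H) : Prop where
  map_zero : ψ 0 = 0
  contDiffOn : ContDiffOn ℝ 1 ψ {0}ᶜ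
  contDiffOn_symm : ContDiffOn ℝ 1 ψ.symm {0}ᶜ
  symplectic : ∀ x : H, x ≠ 0 → ∀ u v : H,
    S.form (fderiv ℝ ψ x u) (fderiv ℝ ψ x v) = S.form u v
  homogeneous : ∀ x : H, ∀ t : ℝ, 0 < t → ψ (t • x) = t • ψ x

end Convex

/-!
The invariance of the capacity follows from `a_∞(C) ≤ a_∞(ψ(C))`, applied to `ψ` and to its inverse.
In infinite dimensions the supremum `a_∞(C)` need not be attained, so instead of closed
characteristics the argument transports *approximate* closed characteristics.

Everything is pulled back to `H` by `Ω⁻¹`. Averaging over short intervals shows that `a_∞(C)` is at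
most the supremum `a` of the action `A(x)` of `C¹` loops under the constraint
`2 ∫ H_{C⁰}(Ω x') ≤ 1` (`SymplecticStructure.aInfty_le_maxAction`). By homogeneity the functional
`2a ∫ H_{C⁰}(Ω x') - A(x)` is non-negative; its gradient is Lipschitz in `L²`, so the square of the
gradient is bounded by a multiple of the value (`SymplecticStructure.exists_gradient_le`). Almost
maximizers thus almost solve the Euler–Lagrange equation, and the Legendre transform, for which
`dH_C` and `dH_{C⁰}` are inverse to each other, turns them into loops `u` with
`2a Ω u' + dH_C(u)` small in `L²`. Along such loops `H_C` is almost constant, uniformly in time, since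
the Hamiltonian vector field is tangent to its level sets
(`SymplecticStructure.exists_isApproxCharacteristic`).

A `1`-homogeneous symplectomorphism `ψ` preserves the Liouville form, by Euler's identity
`dψ(x) x = ψ(x)`, and satisfies `H_{ψ(C)} ∘ ψ = H_C`. It therefore maps approximate closed
characteristics of `C` to those of `ψ(C)`, without changing the action
(`IsHomogeneousSymplectomorphism.isApproxCharacteristic_image`); the boundedness of the differentials
keeps the error small in `L²`.

Finally, if `z` is an approximate closed characteristic of `ψ(C)`, then `dH_{ψ(C)}(z)` has gauge
uniformly close to `1` with respect to the polar of `ψ(C)`, and it has small mean. The primitive of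
`dH_{ψ(C)}(z)` minus its mean is, up to a factor close to `1`, a competitor for `a_∞(ψ(C))` with
action close to `a` (`SymplecticStructure.le_aInfty_of_isApproxCharacteristic`).
-/

/-! ### The `L²` seminorm of curves over one period -/

section L2

variable {E F : Type*} [NormedAddCommGroup E] [NormedAddCommGroup F]

/-- The `L²` seminorm over the period `[0, 1]`. It is used for continuous curves only, so that no
integrability has to be checked. -/
noncomputable def l2Norm (f : ℝ → E) : ℝ := √(∫ t in (0 : ℝ)..1, ‖f t‖ ^ 2)

theorem l2Norm_nonneg (f : ℝ → E) : 0 ≤ l2Norm f := Real.sqrt_nonneg _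

theorem l2Norm_sq (f : ℝ → E) : l2Norm f ^ 2 = ∫ t in (0 : ℝ)..1, ‖f t‖ ^ 2 :=
  Real.sq_sqrt (intervalIntegral.integral_nonneg zero_le_one fun _ _ => by positivity)

theorem integral_norm_mul_norm_le {f : ℝ → E} {g : ℝ → F} (hf : Continuous f)
    (hg : Continuous g) : ∫ t in (0 : ℝ)..1, ‖f t‖ * ‖g t‖ ≤ l2Norm f * l2Norm g := by
  have h : ∀ s : ℝ, 0 ≤ l2Norm f ^ 2 * (s * s) + (2 * ∫ t in (0 : ℝ)..1, ‖f t‖ * ‖g t‖) * s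
      + l2Norm g ^ 2 := by
    intro s
    have h0 : 0 ≤ ∫ t in (0 : ℝ)..1, (‖f t‖ * s + ‖g t‖) ^ 2 :=
      intervalIntegral.integral_nonneg zero_le_one fun _ _ => by positivity
    have h1 : ∫ t in (0 : ℝ)..1, (‖f t‖ * s + ‖g t‖) ^ 2
        = (∫ t in (0 : ℝ)..1, ‖f t‖ ^ 2) * (s * s)
          + (2 * ∫ t in (0 : ℝ)..1, ‖f t‖ * ‖g t‖) * s + ∫ t in (0 : ℝ)..1, ‖g t‖ ^ 2 := by
      rw [← intervalIntegral.integral_mul_const, ← intervalIntegral.integral_const_mul,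
        ← intervalIntegral.integral_mul_const, ← intervalIntegral.integral_add,
        ← intervalIntegral.integral_add]
      · exact intervalIntegral.integral_congr fun t _ => by ring
      all_goals exact Continuous.intervalIntegrable (by fun_prop) _ _
    rwa [l2Norm_sq, l2Norm_sq, ← h1]
  have hd := discrim_le_zero h
  rw [discrim] at hd
  refine abs_le_of_sq_le_sq' ?_ (mul_nonneg (l2Norm_nonneg _) (l2Norm_nonneg _)) |>.2
  nlinarith

theorem integral_norm_le_l2Norm {f : ℝ → E} (hf : Continuous f) :
    ∫ t in (0 : ℝ)..1, ‖f t‖ ≤ l2Norm f := by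
  simpa [l2Norm] using integral_norm_mul_norm_le hf (continuous_const (y := (1 : ℝ)))

theorem l2Norm_le_mul {f : ℝ → E} {g : ℝ → F} (hf : Continuous f) (hg : Continuous g) {c : ℝ}
    (hc : 0 ≤ c) (h : ∀ t ∈ Set.Icc (0 : ℝ) 1, ‖f t‖ ≤ c * ‖g t‖) :
    l2Norm f ≤ c * l2Norm g := by
  refine abs_le_of_sq_le_sq' ?_ (mul_nonneg hc (l2Norm_nonneg _)) |>.2
  rw [mul_pow, l2Norm_sq, l2Norm_sq, ← intervalIntegral.integral_const_mul]
  refine intervalIntegral.integral_mono_on zero_le_one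
    (Continuous.intervalIntegrable (by fun_prop) _ _)
    (Continuous.intervalIntegrable (by fun_prop) _ _) fun t ht => ?_
  rw [← mul_pow]
  exact pow_le_pow_left₀ (norm_nonneg _) (h t ht) 2

theorem l2Norm_le_of_norm_le {f : ℝ → E} (hf : Continuous f) {c : ℝ}
    (hc : 0 ≤ c) (h : ∀ t ∈ Set.Icc (0 : ℝ) 1, ‖f t‖ ≤ c) : l2Norm f ≤ c := by
  have := l2Norm_le_mul hf (continuous_const (y := (1 : ℝ))) hc (by simpa using h)
  simpa [l2Norm] using this

theorem l2Norm_add_le {f g : ℝ → E} (hf : Continuous f) (hg : Continuous g) :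
    l2Norm (fun t => f t + g t) ≤ l2Norm f + l2Norm g := by
  refine abs_le_of_sq_le_sq' ?_ (add_nonneg (l2Norm_nonneg _) (l2Norm_nonneg _)) |>.2
  have h1 : l2Norm (fun t => f t + g t) ^ 2 ≤ ∫ t in (0 : ℝ)..1,
      (‖f t‖ ^ 2 + 2 * (‖f t‖ * ‖g t‖) + ‖g t‖ ^ 2) := by
    rw [l2Norm_sq]
    refine intervalIntegral.integral_mono_on zero_le_one
      (Continuous.intervalIntegrable (by fun_prop) _ _)
      (Continuous.intervalIntegrable (by fun_prop) _ _) fun t ht => ?_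
    nlinarith [norm_add_le (f t) (g t), norm_nonneg (f t + g t), norm_nonneg (f t),
      norm_nonneg (g t)]
  rw [intervalIntegral.integral_add, intervalIntegral.integral_add,
    intervalIntegral.integral_const_mul, ← l2Norm_sq, ← l2Norm_sq] at h1
  · nlinarith [integral_norm_mul_norm_le hf hg]
  all_goals exact Continuous.intervalIntegrable (by fun_prop) _ _

end L2

/-! ### Functions with Lipschitz differential -/

theorem abs_sub_sub_fderiv_le {E : Type*} [NormedAddCommGroup E] [NormedSpace ℝ E] {f : E → ℝ}
    (hf : Differentiable ℝ f) {K : NNReal} (hK : LipschitzWith K (fderiv ℝ f)) (p q : E) :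
    |f (p + q) - f p - fderiv ℝ f p q| ≤ K * ‖q‖ ^ 2 := by
  have h := (convex_segment p (p + q)).norm_image_sub_le_of_norm_fderiv_le' (𝕜 := ℝ) (f := f)
    (φ := fderiv ℝ f p) (C := K * ‖q‖) (fun x _ => hf x) (fun x hx => ?_)
    (left_mem_segment ℝ p (p + q)) (right_mem_segment ℝ p (p + q))
  · simpa [mul_assoc, pow_two] using h
  · refine (hK.norm_sub_le x p).trans ?_
    gcongr
    obtain ⟨s, hs, rfl⟩ := (segment_eq_image' ℝ p (p + q)).subset hx
    simpa [norm_smul, abs_of_nonneg hs.1] using mul_le_of_le_one_left (norm_nonneg q) hs.2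

/-! ### Gauges, polars and the Legendre transform -/

section GaugeHamiltonian

variable {E : Type*} [NormedAddCommGroup E] [NormedSpace ℝ E] {B : Set E}

/-- The Cauchy–Schwarz type inequality for the differential of `μ_B² / 2`. -/
theorem fderiv_gaugeHamiltonian_le (hB : Convex ℝ B) (h0 : B ∈ 𝓝 (0 : E)) {p : E}
    (hd : DifferentiableAt ℝ (gaugeHamiltonian B) p) (q : E) :
    fderiv ℝ (gaugeHamiltonian B) p q ≤ gauge B p * gauge B q := by
  have hline : HasDerivAt (fun s : ℝ => p + s • q) q 0 := by
    simpa using ((hasDerivAt_id (0 : ℝ)).smul_const q).const_add p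
  have h1 : HasDerivAt (fun s : ℝ => gaugeHamiltonian B (p + s • q))
      (fderiv ℝ (gaugeHamiltonian B) p q) 0 :=
    HasFDerivAt.comp_hasDerivAt (l := gaugeHamiltonian B) (0 : ℝ)
      (by simpa using hd.hasFDerivAt) hline
  have h2 : HasDerivAt (fun s : ℝ => (1 / 2) * (gauge B p + s * gauge B q) ^ 2)
      (gauge B p * gauge B q) 0 := by
    have := ((((hasDerivAt_id (0 : ℝ)).mul_const (gauge B q)).const_add (gauge B p)).pow 2
      ).const_mul (1 / 2)
    exact this.congr_deriv (by simp; ring)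
  have h3 := (h2.sub h1).tendsto_slope_zero_right
  have h4 := ge_of_tendsto (b := (0 : ℝ)) h3 ?_
  · linarith
  filter_upwards [self_mem_nhdsWithin] with s hs
  have hs : 0 < s := hs
  have h5 : gauge B (p + s • q) ≤ gauge B p + s * gauge B q := by
    have := gauge_add_le hB (absorbent_nhds_zero h0) p (s • q)
    rwa [gauge_smul_of_nonneg hs.le, smul_eq_mul] at this
  have h6 : gaugeHamiltonian B (p + s • q) ≤ (1 / 2) * (gauge B p + s * gauge B q) ^ 2 := by
    unfold gaugeHamiltonian
    have := pow_le_pow_left₀ (gauge_nonneg _) h5 2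
    linarith
  simp only [zero_add, Pi.sub_apply, zero_smul, add_zero, zero_mul, smul_eq_mul]
  refine mul_nonneg (by positivity) ?_
  have : gaugeHamiltonian B p = 1 / 2 * gauge B p ^ 2 := rfl
  linarith

theorem gaugeHamiltonian_smul {t : ℝ} (ht : 0 ≤ t) (p : E) :
    gaugeHamiltonian B (t • p) = t ^ 2 * gaugeHamiltonian B p := by
  unfold gaugeHamiltonian
  rw [gauge_smul_of_nonneg ht, smul_eq_mul]
  ring

/-- Euler's identity for the `2`-homogeneous function `μ_B² / 2`. -/
theorem fderiv_gaugeHamiltonian_self {p : E}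
    (hd : DifferentiableAt ℝ (gaugeHamiltonian B) p) :
    fderiv ℝ (gaugeHamiltonian B) p p = gauge B p ^ 2 := by
  have hline : HasDerivAt (fun s : ℝ => s • p) p 1 := by
    simpa using (hasDerivAt_id (1 : ℝ)).smul_const p
  have h1 : HasDerivAt (fun s : ℝ => gaugeHamiltonian B (s • p))
      (fderiv ℝ (gaugeHamiltonian B) p p) 1 :=
    HasFDerivAt.comp_hasDerivAt (l := gaugeHamiltonian B) (1 : ℝ)
      (by simpa using hd.hasFDerivAt) hline
  have h2 : HasDerivAt (fun s : ℝ => s ^ 2 * gaugeHamiltonian B p)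
      (gauge B p ^ 2) 1 := by
    exact ((hasDerivAt_pow 2 (1 : ℝ)).mul_const (gaugeHamiltonian B p)).congr_deriv
      (by simp [gaugeHamiltonian])
  refine h1.unique (h2.congr_of_eventuallyEq ?_)
  filter_upwards [lt_mem_nhds (zero_lt_one (α := ℝ))] with s hs
  exact gaugeHamiltonian_smul hs.le p

theorem gaugeHamiltonian_nonneg (p : E) : 0 ≤ gaugeHamiltonian B p := by
  unfold gaugeHamiltonian; positivity

end GaugeHamiltonian

section Polar

variable {H : Type*} [NormedAddCommGroup H] [InnerProductSpace ℝ H] {C : Set H}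

theorem convex_polarSet (C : Set H) : Convex ℝ (polarSet C) := by
  intro ξ hξ η hη a b ha hb hab x hx
  have h1 := hξ x hx
  have h2 := hη x hx
  simp only [add_apply, smul_apply, smul_eq_mul]
  nlinarith

theorem IsConvexNhd.zero_mem (hC : IsConvexNhd C) : (0 : H) ∈ C := mem_of_mem_nhds hC.mem_nhds

theorem IsConvexNhd.polarSet_mem_nhds (hC : IsConvexNhd C) :
    polarSet C ∈ 𝓝 (0 : StrongDual ℝ H) := by
  obtain ⟨R, hR0, hR⟩ := hC.isBounded.exists_pos_norm_le
  refine Filter.mem_of_superset (Metric.ball_mem_nhds 0 (inv_pos.2 hR0)) fun ξ hξ x hx => ?_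
  rw [mem_ball_zero_iff] at hξ
  calc ξ x ≤ ‖ξ x‖ := le_abs_self _
    _ ≤ ‖ξ‖ * ‖x‖ := ξ.le_opNorm x
    _ ≤ R⁻¹ * R := by gcongr; exact hR x hx
    _ = 1 := inv_mul_cancel₀ hR0.ne'

theorem gauge_polarSet_le {ξ : StrongDual ℝ H} {r : ℝ} (hr : 0 ≤ r)
    (h : ∀ x ∈ C, ξ x ≤ r) : gauge (polarSet C) ξ ≤ r := by
  refine le_of_forall_gt_imp_ge_of_dense fun s hs => ?_
  have hs0 : 0 < s := hr.trans_lt hs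
  refine gauge_le_of_mem hs0.le ((Set.mem_smul_set_iff_inv_smul_mem₀ hs0.ne' _ _).2 fun x hx => ?_)
  rw [smul_apply, smul_eq_mul, inv_mul_le_iff₀ hs0]
  linarith [h x hx]

/-- The bipolar theorem, in terms of gauges. -/
theorem IsConvexNhd.gauge_le (hC : IsConvexNhd C) {x : H} {r : ℝ} (hr : 0 ≤ r)
    (h : ∀ ξ ∈ polarSet C, ξ x ≤ r) : gauge C x ≤ r := by
  refine le_of_forall_gt_imp_ge_of_dense fun s hs => ?_
  have hs0 : 0 < s := hr.trans_lt hs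
  refine gauge_le_of_mem hs0.le ((Set.mem_smul_set_iff_inv_smul_mem₀ hs0.ne' _ _).2 ?_)
  by_contra hx
  obtain ⟨f, u, hfu, hux⟩ := geometric_hahn_banach_closed_point hC.convex hC.isClosed hx
  have hu : 0 < u := by simpa using hfu 0 hC.zero_mem
  have hmem : u⁻¹ • f ∈ polarSet C := fun y hy => by
    rw [smul_apply, smul_eq_mul, inv_mul_le_iff₀ hu]
    linarith [hfu y hy]
  have h1 := h _ hmem
  rw [smul_apply, smul_eq_mul, inv_mul_le_iff₀ hu] at h1
  rw [map_smul, smul_eq_mul, lt_inv_mul_iff₀ hs0] at hux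
  nlinarith

theorem IsConvexNhd.apply_le_gauge_of_mem (hC : IsConvexNhd C) (ξ : StrongDual ℝ H) {x : H}
    (hx : x ∈ C) : ξ x ≤ gauge (polarSet C) ξ := by
  refine le_of_forall_gt_imp_ge_of_dense fun s hs => ?_
  obtain ⟨b, hb, hbs, hmem⟩ :=
    exists_lt_of_gauge_lt (absorbent_nhds_zero hC.polarSet_mem_nhds) hs
  obtain ⟨η, hη, rfl⟩ := hmem
  have := hη x hx
  simp only [smul_apply, smul_eq_mul]
  nlinarith

theorem IsConvexNhd.apply_le_gauge_mul_gauge (hC : IsConvexNhd C) (ξ : StrongDual ℝ H) (x : H) :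
    ξ x ≤ gauge (polarSet C) ξ * gauge C x := by
  have key : ∀ s, gauge C x < s → ξ x ≤ gauge (polarSet C) ξ * s := by
    intro s hs
    obtain ⟨b, hb, hbs, hmem⟩ := exists_lt_of_gauge_lt (absorbent_nhds_zero hC.mem_nhds) hs
    obtain ⟨y, hy, rfl⟩ := hmem
    have := hC.apply_le_gauge_of_mem ξ hy
    simp only [map_smul, smul_eq_mul]
    nlinarith [gauge_nonneg (s := polarSet C) ξ]
  refine ge_of_tendsto (x := 𝓝[>] gauge C x)
    (f := fun s => gauge (polarSet C) ξ * s) ?_ ?_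
  · exact (continuous_const.mul continuous_id).continuousWithinAt
  · filter_upwards [self_mem_nhdsWithin] with s hs using key s hs

theorem IsConvexNhd.mem_polarSet (hC : IsConvexNhd C) {ξ : StrongDual ℝ H}
    (h : gauge (polarSet C) ξ ≤ 1) : ξ ∈ polarSet C :=
  fun _ hx => (hC.apply_le_gauge_of_mem ξ hx).trans h

theorem IsConvexNhd.exists_gauge_polarSet_le (hC : IsConvexNhd C) :
    ∃ R > 0, ∀ ξ : StrongDual ℝ H, gauge (polarSet C) ξ ≤ R * ‖ξ‖ := by
  obtain ⟨R, hR0, hR⟩ := hC.isBounded.exists_pos_norm_le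
  refine ⟨R, hR0, fun ξ => gauge_polarSet_le (by positivity) fun x hx => ?_⟩
  calc ξ x ≤ ‖ξ x‖ := le_abs_self _
    _ ≤ ‖ξ‖ * ‖x‖ := ξ.le_opNorm x
    _ ≤ ‖ξ‖ * R := by gcongr; exact hR x hx
    _ = R * ‖ξ‖ := mul_comm _ _

theorem IsConvexNhd.exists_norm_le_gauge_polarSet (hC : IsConvexNhd C) :
    ∃ R > 0, ∀ ξ : StrongDual ℝ H, ‖ξ‖ ≤ R * gauge (polarSet C) ξ := by
  obtain ⟨r, hr0, hr⟩ := Metric.mem_nhds_iff.1 hC.mem_nhds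
  have h1 : ∀ (ξ : StrongDual ℝ H) (x : H), ξ x ≤ r⁻¹ * gauge (polarSet C) ξ * ‖x‖ := by
    intro ξ x
    have h2 := mul_gauge_le_norm (x := x) hr
    have h3 : gauge C x ≤ r⁻¹ * ‖x‖ := by rwa [le_inv_mul_iff₀ hr0]
    calc ξ x ≤ gauge (polarSet C) ξ * gauge C x := hC.apply_le_gauge_mul_gauge ξ x
      _ ≤ gauge (polarSet C) ξ * (r⁻¹ * ‖x‖) :=
        mul_le_mul_of_nonneg_left h3 (gauge_nonneg _)
      _ = _ := by ring
  refine ⟨r⁻¹, inv_pos.2 hr0, fun ξ => ξ.opNorm_le_bound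
    (mul_nonneg (inv_pos.2 hr0).le (gauge_nonneg _)) fun x => abs_le.2 ⟨?_, h1 ξ x⟩⟩
  have := h1 ξ (-x)
  rw [map_neg, norm_neg] at this
  linarith

end Polar

section Bidual

variable {H : Type*} [NormedAddCommGroup H] [InnerProductSpace ℝ H] [CompleteSpace H]

theorem inclusionInDoubleDualLi_surjective :
    Function.Surjective (NormedSpace.inclusionInDoubleDualLi (E := H) ℝ) := by
  intro Φ
  let f : StrongDual ℝ H := LinearMap.mkContinuous
    { toFun := fun y => Φ (InnerProductSpace.toDual ℝ H y)
      map_add' := fun y z => by simp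
      map_smul' := fun c y => by simp } ‖Φ‖ fun y => by
        simpa using Φ.le_opNorm (InnerProductSpace.toDual ℝ H y)
  refine ⟨(InnerProductSpace.toDual ℝ H).symm f, ?_⟩
  ext ξ
  obtain ⟨y, rfl⟩ := (InnerProductSpace.toDual ℝ H).surjective ξ
  have : inner ℝ ((InnerProductSpace.toDual ℝ H).symm f) y = f y :=
    InnerProductSpace.toDual_symm_apply
  rw [real_inner_comm] at this
  exact this

/-- Reflexivity of a Hilbert space: the inverse of this isometry represents elements of the bidual
by vectors. -/
noncomputable def bidualEquiv : H ≃ₗᵢ[ℝ] StrongDual ℝ (StrongDual ℝ H) :=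
  LinearIsometryEquiv.ofSurjective _ inclusionInDoubleDualLi_surjective

theorem apply_bidualEquiv_symm (Φ : StrongDual ℝ (StrongDual ℝ H)) (ξ : StrongDual ℝ H) :
    ξ (bidualEquiv.symm Φ) = Φ ξ := by
  obtain ⟨x, rfl⟩ := (bidualEquiv (H := H)).surjective Φ
  rw [LinearIsometryEquiv.symm_apply_apply]
  rfl

variable {C : Set H}

/-- The Legendre transform: `X = dH_{C⁰}(ξ)`, seen as a vector of `H` by reflexivity. -/
noncomputable def legendre (C : Set H) (ξ : StrongDual ℝ H) : H :=
  bidualEquiv.symm (fderiv ℝ (gaugeHamiltonian (polarSet C)) ξ)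

theorem apply_legendre (ξ η : StrongDual ℝ H) :
    η (legendre C ξ) = fderiv ℝ (gaugeHamiltonian (polarSet C)) ξ η :=
  apply_bidualEquiv_symm _ _

theorem IsRegularConvexNhd.continuous_legendre (hC : IsRegularConvexNhd C) :
    Continuous (legendre C) :=
  bidualEquiv.symm.continuous.comp (hC.contDiff_polar.continuous_fderiv one_ne_zero)

theorem IsRegularConvexNhd.gauge_legendre (hC : IsRegularConvexNhd C) (ξ : StrongDual ℝ H) :
    gauge C (legendre C ξ) = gauge (polarSet C) ξ := by
  have hd : DifferentiableAt ℝ (gaugeHamiltonian (polarSet C)) ξ :=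
    hC.contDiff_polar.differentiable one_ne_zero ξ
  have hle : gauge C (legendre C ξ) ≤ gauge (polarSet C) ξ := by
    refine hC.gauge_le (gauge_nonneg _) fun η hη => ?_
    rw [apply_legendre]
    exact (fderiv_gaugeHamiltonian_le (convex_polarSet C) hC.polarSet_mem_nhds hd η).trans
      (mul_le_of_le_one_right (gauge_nonneg _) (gauge_le_one_of_mem hη))
  refine le_antisymm hle ?_
  have h1 := hC.apply_le_gauge_mul_gauge ξ (legendre C ξ)
  rw [apply_legendre, fderiv_gaugeHamiltonian_self hd, pow_two] at h1
  rcases (gauge_nonneg (s := polarSet C) ξ).eq_or_lt with h0 | h0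
  · rw [← h0]; exact gauge_nonneg _
  · exact le_of_mul_le_mul_left h1 h0

theorem IsRegularConvexNhd.gaugeHamiltonian_legendre (hC : IsRegularConvexNhd C)
    (ξ : StrongDual ℝ H) :
    gaugeHamiltonian C (legendre C ξ) = gaugeHamiltonian (polarSet C) ξ := by
  unfold gaugeHamiltonian
  rw [hC.gauge_legendre]

/-- `dH_C` inverts the Legendre transform: by Young's inequality `H_C - ξ` is minimal at
`legendre C ξ`. -/
theorem IsRegularConvexNhd.fderiv_legendre (hC : IsRegularConvexNhd C) (ξ : StrongDual ℝ H) :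
    fderiv ℝ (gaugeHamiltonian C) (legendre C ξ) = ξ := by
  have hd : DifferentiableAt ℝ (gaugeHamiltonian (polarSet C)) ξ :=
    hC.contDiff_polar.differentiable one_ne_zero ξ
  have hmin : IsLocalMin (fun x => gaugeHamiltonian C x - ξ x) (legendre C ξ) := by
    refine Filter.Eventually.of_forall fun x => ?_
    simp only
    rw [apply_legendre, fderiv_gaugeHamiltonian_self hd]
    unfold gaugeHamiltonian
    rw [hC.gauge_legendre]
    nlinarith [hC.apply_le_gauge_mul_gauge ξ x, sq_nonneg (gauge (polarSet C) ξ - gauge C x)]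
  have h := hmin.fderiv_eq_zero
  rw [fderiv_fun_sub (hC.contDiff.differentiable one_ne_zero _) ξ.differentiableAt,
    ContinuousLinearMap.fderiv, sub_eq_zero] at h
  exact h

end Bidual

/-! ### Loops of class `C¹` and their action -/

/-- A `C¹` loop on `ℝ/ℤ`, as a `1`-periodic curve `x` on `ℝ` together with its derivative `x'`. -/
structure IsLoop {E : Type*} [NormedAddCommGroup E] [NormedSpace ℝ E] (x x' : ℝ → E) : Prop where
  periodic : Function.Periodic x 1
  hasDerivAt : ∀ t, HasDerivAt x (x' t) t
  continuous_deriv : Continuous x'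

namespace IsLoop

variable {E F : Type*} [NormedAddCommGroup E] [NormedSpace ℝ E] [NormedAddCommGroup F]
  [NormedSpace ℝ F] {x x' y y' : ℝ → E}

theorem continuous (hx : IsLoop x x') : Continuous x :=
  continuous_iff_continuousAt.2 fun t => (hx.hasDerivAt t).continuousAt

theorem periodic_deriv (hx : IsLoop x x') : Function.Periodic x' 1 := fun t => by
  have h := (hx.hasDerivAt (t + 1)).comp_add_const t 1
  rw [funext hx.periodic] at h
  exact h.unique (hx.hasDerivAt t)

theorem add (hx : IsLoop x x') (hy : IsLoop y y') :
    IsLoop (fun t => x t + y t) fun t => x' t + y' t :=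
  ⟨hx.periodic.add hy.periodic, fun t => (hx.hasDerivAt t).add (hy.hasDerivAt t),
    hx.continuous_deriv.add hy.continuous_deriv⟩

theorem const_smul (hx : IsLoop x x') (r : ℝ) :
    IsLoop (fun t => r • x t) fun t => r • x' t :=
  ⟨fun t => by simp only [hx.periodic t], fun t => (hx.hasDerivAt t).const_smul r,
    hx.continuous_deriv.const_smul r⟩

theorem const_add (hx : IsLoop x x') (m : E) : IsLoop (fun t => m + x t) x' :=
  ⟨fun t => by simp only [hx.periodic t], fun t => (hx.hasDerivAt t).const_add m,
    hx.continuous_deriv⟩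

theorem map (hx : IsLoop x x') (L : E →L[ℝ] F) :
    IsLoop (fun t => L (x t)) fun t => L (x' t) :=
  ⟨fun t => by simp only [hx.periodic t], fun t => L.hasFDerivAt.comp_hasDerivAt t (hx.hasDerivAt t),
    L.continuous.comp hx.continuous_deriv⟩

variable [CompleteSpace E]

theorem integral_deriv_eq_sub (hx : IsLoop x x') (s t : ℝ) : ∫ r in s..t, x' r = x t - x s :=
  intervalIntegral.integral_eq_sub_of_hasDerivAt (fun r _ => hx.hasDerivAt r)
    (hx.continuous_deriv.intervalIntegrable _ _)

theorem integral_deriv (hx : IsLoop x x') : ∫ r in (0 : ℝ)..1, x' r = 0 := by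
  have := hx.periodic 0
  rw [zero_add] at this
  rw [hx.integral_deriv_eq_sub, this, sub_self]

theorem norm_sub_le_integral (hx : IsLoop x x') {t : ℝ} (ht : t ∈ Set.Icc (0 : ℝ) 1) :
    ‖x t - x 0‖ ≤ ∫ s in (0 : ℝ)..1, ‖x' s‖ := by
  rw [← hx.integral_deriv_eq_sub]
  refine (intervalIntegral.norm_integral_le_integral_norm ht.1).trans ?_
  exact intervalIntegral.integral_mono_interval le_rfl ht.1 ht.2
    (Filter.Eventually.of_forall fun _ => norm_nonneg _)
    (hx.continuous_deriv.norm.intervalIntegrable _ _)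

/-- A continuous periodic function of mean zero is the derivative of a loop. -/
theorem of_integral_eq_zero {v : ℝ → E} (hv : Continuous v) (hp : Function.Periodic v 1)
    (h0 : ∫ t in (0 : ℝ)..1, v t = 0) : IsLoop (fun t => ∫ s in (0 : ℝ)..t, v s) v := by
  refine ⟨fun t => ?_, fun t => intervalIntegral.integral_hasDerivAt_right
    (hv.intervalIntegrable _ _) (hv.stronglyMeasurableAtFilter _ _) hv.continuousAt, hv⟩
  have h1 := hp.intervalIntegral_add_eq t 0
  rw [zero_add, h0] at h1
  rw [← intervalIntegral.integral_add_adjacent_intervals (hv.intervalIntegrable 0 t)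
    (hv.intervalIntegrable t (t + 1)), h1, add_zero]

end IsLoop

namespace SymplecticStructure

variable {H : Type*} [NormedAddCommGroup H] [InnerProductSpace ℝ H] (S : SymplecticStructure H)

theorem form_skew (x y : H) : S.form x y = -S.form y x := S.skew x y

theorem form_self (x : H) : S.form x x = 0 := by have := S.form_skew x x; linarith

theorem form_add_left (x y z : H) : S.form (x + y) z = S.form x z + S.form y z := by
  simp [form]

theorem form_add_right (x y z : H) : S.form x (y + z) = S.form x y + S.form x z := by
  simp [form]

theorem form_smul_left (r : ℝ) (x y : H) : S.form (r • x) y = r * S.form x y := by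
  simp [form]

theorem form_smul_right (r : ℝ) (x y : H) : S.form x (r • y) = r * S.form x y := by
  simp [form]

theorem form_sub_left (x y z : H) : S.form (x - y) z = S.form x z - S.form y z := by
  simp [form]

/-- The operator norm of `Ω`. -/
noncomputable def bound : ℝ := ‖(S.Omega : H →L[ℝ] StrongDual ℝ H)‖

theorem bound_nonneg : 0 ≤ S.bound := by unfold bound; positivity

theorem norm_Omega_le (x : H) : ‖S.Omega x‖ ≤ S.bound * ‖x‖ :=
  (S.Omega : H →L[ℝ] StrongDual ℝ H).le_opNorm x

theorem abs_form_le (x y : H) : |S.form x y| ≤ S.bound * (‖x‖ * ‖y‖) := by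
  rw [← mul_assoc]
  exact ((S.Omega x).le_opNorm y).trans (by gcongr; exact S.norm_Omega_le x)

/-- The operator norm of `Ω⁻¹`. -/
noncomputable def boundSymm : ℝ := ‖(S.Omega.symm : StrongDual ℝ H →L[ℝ] H)‖

theorem boundSymm_nonneg : 0 ≤ S.boundSymm := by unfold boundSymm; positivity

theorem norm_Omega_symm_le (ξ : StrongDual ℝ H) : ‖S.Omega.symm ξ‖ ≤ S.boundSymm * ‖ξ‖ :=
  (S.Omega.symm : StrongDual ℝ H →L[ℝ] H).le_opNorm ξ

theorem continuous_form {X : Type*} [TopologicalSpace X] {f g : X → H} (hf : Continuous f)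
    (hg : Continuous g) : Continuous fun t => S.form (f t) (g t) :=
  (S.Omega.continuous.comp hf).clm_apply hg

/-- The action of a loop in `H`, for the Liouville form `ω(x, ·) / 2`. -/
noncomputable def loopAction (x x' : ℝ → H) : ℝ := ∫ t in (0 : ℝ)..1, (1 / 2) * S.form (x t) (x' t)

theorem two_mul_loopAction (x x' : ℝ → H) :
    2 * S.loopAction x x' = ∫ t in (0 : ℝ)..1, S.form (x t) (x' t) := by
  rw [loopAction, intervalIntegral.integral_const_mul]; ring

theorem loopAction_smul (x x' : ℝ → H) (r : ℝ) :
    S.loopAction (fun t => r • x t) (fun t => r • x' t) = r ^ 2 * S.loopAction x x' := by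
  rw [loopAction, loopAction, ← intervalIntegral.integral_const_mul]
  refine intervalIntegral.integral_congr fun t _ => ?_
  simp only [form_smul_left, form_smul_right]
  ring

variable {x x' y y' : ℝ → H}

/-- Integration by parts. -/
theorem integral_form_symm (hx : IsLoop x x') (hy : IsLoop y y') :
    ∫ t in (0 : ℝ)..1, S.form (x t) (y' t) = ∫ t in (0 : ℝ)..1, S.form (y t) (x' t) := by
  have hd : ∀ t, HasDerivAt (fun t => S.form (x t) (y t))
      (S.form (x' t) (y t) + S.form (x t) (y' t)) t := fun t =>
    ((S.Omega : H →L[ℝ] StrongDual ℝ H).hasFDerivAt.comp_hasDerivAt t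
      (hx.hasDerivAt t)).clm_apply (hy.hasDerivAt t)
  have c1 := S.continuous_form hx.continuous_deriv hy.continuous
  have c2 := S.continuous_form hx.continuous hy.continuous_deriv
  have h := intervalIntegral.integral_eq_sub_of_hasDerivAt (a := 0) (b := 1) (fun t _ => hd t)
    ((c1.fun_add c2).intervalIntegrable _ _)
  have h1 := hx.periodic 0
  have h2 := hy.periodic 0
  rw [zero_add] at h1 h2
  rw [h1, h2, sub_self, intervalIntegral.integral_add (c1.intervalIntegrable _ _)
    (c2.intervalIntegrable _ _)] at h
  have h3 : ∫ t in (0 : ℝ)..1, S.form (x' t) (y t) = -∫ t in (0 : ℝ)..1, S.form (y t) (x' t) := by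
    rw [← intervalIntegral.integral_neg]
    exact intervalIntegral.integral_congr fun t _ => S.form_skew _ _
  linarith

theorem loopAction_add (hx : IsLoop x x') (hy : IsLoop y y') :
    S.loopAction (fun t => x t + y t) (fun t => x' t + y' t)
      = S.loopAction x x' + (∫ t in (0 : ℝ)..1, S.form (x t) (y' t)) + S.loopAction y y' := by
  have c1 := S.continuous_form hx.continuous hx.continuous_deriv
  have c2 := S.continuous_form hx.continuous hy.continuous_deriv
  have c3 := S.continuous_form hy.continuous hx.continuous_deriv
  have c4 := S.continuous_form hy.continuous hy.continuous_deriv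
  have h := S.two_mul_loopAction (fun t => x t + y t) (fun t => x' t + y' t)
  have h2 : ∫ t in (0 : ℝ)..1, S.form (x t + y t) (x' t + y' t)
      = ∫ t in (0 : ℝ)..1, (S.form (x t) (x' t) + S.form (x t) (y' t)
        + (S.form (y t) (x' t) + S.form (y t) (y' t))) :=
    intervalIntegral.integral_congr fun t _ => by
      simp only [form_add_left, form_add_right]; ring
  rw [h2, intervalIntegral.integral_add ((c1.fun_add c2).intervalIntegrable _ _)
    ((c3.fun_add c4).intervalIntegrable _ _), intervalIntegral.integral_add
    (c1.intervalIntegrable _ _) (c2.intervalIntegrable _ _), intervalIntegral.integral_add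
    (c3.intervalIntegrable _ _) (c4.intervalIntegrable _ _), ← S.integral_form_symm hx hy] at h
  linarith [S.two_mul_loopAction x x', S.two_mul_loopAction y y']

variable [CompleteSpace H]

theorem integral_form_const (m : H) (hy : IsLoop y y') :
    ∫ t in (0 : ℝ)..1, S.form m (y' t) = 0 := by
  have := (S.Omega m).intervalIntegral_comp_comm (hy.continuous_deriv.intervalIntegrable
    (μ := MeasureTheory.volume) 0 1)
  rw [hy.integral_deriv, map_zero] at this
  exact this

theorem loopAction_const_add (m : H) (hx : IsLoop x x') :
    S.loopAction (fun t => m + x t) x' = S.loopAction x x' := by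
  have h := S.two_mul_loopAction (fun t => m + x t) x'
  simp only [form_add_left] at h
  rw [intervalIntegral.integral_add
    ((S.continuous_form continuous_const hx.continuous_deriv).intervalIntegrable _ _)
    ((S.continuous_form hx.continuous hx.continuous_deriv).intervalIntegrable _ _),
    S.integral_form_const m hx, ← two_mul_loopAction] at h
  linarith

theorem abs_integral_form_le (hx : IsLoop x x') (hy : IsLoop y y') :
    |∫ t in (0 : ℝ)..1, S.form (x t) (y' t)| ≤ S.bound * (l2Norm x' * l2Norm y') := by
  have c1 := S.continuous_form hx.continuous hy.continuous_deriv
  have c2 := S.continuous_form (f := fun _ => x 0) continuous_const hy.continuous_deriv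
  have h1 : ∫ t in (0 : ℝ)..1, S.form (x t) (y' t)
      = ∫ t in (0 : ℝ)..1, S.form (x t - x 0) (y' t) := by
    simp only [form_sub_left]
    rw [intervalIntegral.integral_sub (c1.intervalIntegrable _ _) (c2.intervalIntegrable _ _),
      S.integral_form_const _ hy, sub_zero]
  have c3 := S.continuous_form (f := fun t => x t - x 0)
    (hx.continuous.sub continuous_const) hy.continuous_deriv
  rw [h1]
  refine (intervalIntegral.abs_integral_le_integral_abs zero_le_one).trans ?_
  calc ∫ t in (0 : ℝ)..1, |S.form (x t - x 0) (y' t)|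
      ≤ ∫ t in (0 : ℝ)..1, S.bound * l2Norm x' * ‖y' t‖ := by
        refine intervalIntegral.integral_mono_on zero_le_one (c3.abs.intervalIntegrable _ _)
          ((continuous_const.mul hy.continuous_deriv.norm).intervalIntegrable _ _) fun t ht => ?_
        refine (S.abs_form_le _ _).trans ?_
        rw [mul_assoc]
        have := S.bound_nonneg
        gcongr
        exact (hx.norm_sub_le_integral ht).trans (integral_norm_le_l2Norm hx.continuous_deriv)
    _ = S.bound * l2Norm x' * ∫ t in (0 : ℝ)..1, ‖y' t‖ :=
        intervalIntegral.integral_const_mul _ _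
    _ ≤ S.bound * l2Norm x' * l2Norm y' :=
        mul_le_mul_of_nonneg_left (integral_norm_le_l2Norm hy.continuous_deriv)
          (mul_nonneg S.bound_nonneg (l2Norm_nonneg _))
    _ = _ := mul_assoc _ _ _

theorem abs_loopAction_le (hx : IsLoop x x') :
    |S.loopAction x x'| ≤ S.bound * l2Norm x' ^ 2 := by
  have h := S.abs_integral_form_le hx hx
  rw [← two_mul_loopAction, abs_mul, abs_two] at h
  nlinarith [abs_nonneg (S.loopAction x x')]

/-- The action is continuous for the `W^{1,2}` topology: if the derivatives of two loops are close
in `L²`, so are their actions. -/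
theorem abs_loopAction_add_sub_le (hx : IsLoop x x') (hy : IsLoop y y') :
    |S.loopAction (fun t => x t + y t) (fun t => x' t + y' t) - S.loopAction x x'|
      ≤ S.bound * (l2Norm x' * l2Norm y' + l2Norm y' ^ 2) := by
  rw [S.loopAction_add hx hy]
  have h1 := abs_le.1 (S.abs_integral_form_le hx hy)
  have h2 := abs_le.1 (S.abs_loopAction_le hy)
  rw [abs_le]
  constructor <;> linarith [h1.1, h1.2, h2.1, h2.2]

end SymplecticStructure

/-! ### Absolutely continuous loops with derivative in the polar -/

theorem AbsolutelyContinuousOnInterval.clm_apply_const {H : Type*} [NormedAddCommGroup H]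
    [NormedSpace ℝ H] {ξ : ℝ → StrongDual ℝ H} {a b : ℝ}
    (h : AbsolutelyContinuousOnInterval ξ a b) (y : H) :
    AbsolutelyContinuousOnInterval (fun t => ξ t y) a b := by
  unfold AbsolutelyContinuousOnInterval at h ⊢
  have h2 := h.mul_const ‖y‖
  rw [zero_mul] at h2
  refine squeeze_zero (fun _ => Finset.sum_nonneg fun _ _ => dist_nonneg) (fun I => ?_) h2
  rw [Finset.sum_mul]
  refine Finset.sum_le_sum fun i _ => ?_
  rw [dist_eq_norm, dist_eq_norm, ← sub_apply]
  exact ContinuousLinearMap.le_opNorm _ _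

namespace IsPolarLoop

variable {H : Type*} [NormedAddCommGroup H] [InnerProductSpace ℝ H] {C : Set H}
  {ξ : ℝ → StrongDual ℝ H}

theorem apply_sub_apply_le_of_mem_Icc (hξ : IsPolarLoop C ξ) {y : H} (hy : y ∈ C) {s t : ℝ}
    (hs : 0 ≤ s) (hst : s ≤ t) (ht : t ≤ 1) : ξ t y - ξ s y ≤ t - s := by
  have hac : AbsolutelyContinuousOnInterval (fun r => ξ r y) s t :=
    (hξ.absolutelyContinuous.clm_apply_const y).mono (by
      rw [Set.uIcc_of_le hst, Set.uIcc_of_le zero_le_one]; exact Set.Icc_subset_Icc hs ht)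
  rw [← hac.integral_deriv_eq_sub]
  calc ∫ r in s..t, deriv (fun r => ξ r y) r ≤ ∫ _ in s..t, (1 : ℝ) := by
        refine intervalIntegral.integral_mono_ae hst hac.intervalIntegrable_deriv
          intervalIntegrable_const ?_
        filter_upwards [hξ.deriv_mem] with r hr
        have : HasDerivAt (fun r => ξ r y) (deriv ξ r y) r := by
          simpa using hr.1.hasDerivAt.clm_apply (hasDerivAt_const r y)
        rw [this.deriv]
        exact hr.2 y hy
    _ = t - s := by simp

theorem apply_sub_apply_le (hξ : IsPolarLoop C ξ) {y : H} (hy : y ∈ C) {s t : ℝ}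
    (hst : s ≤ t) : ξ t y - ξ s y ≤ t - s := by
  have hf : ∀ r, ξ r = ξ (Int.fract r) := fun r => by
    have := hξ.periodic.sub_int_mul_eq (x := r) ⌊r⌋
    rwa [mul_one, Int.self_sub_floor, eq_comm] at this
  have h1 : ξ 1 = ξ 0 := by simpa using hξ.periodic 0
  rw [hf t, hf s]
  have hs := Int.floor_add_fract s
  have ht := Int.floor_add_fract t
  rcases (Int.floor_mono hst).eq_or_lt with h | h
  · rw [h] at hs
    have := hξ.apply_sub_apply_le_of_mem_Icc hy (Int.fract_nonneg s)
      (t := Int.fract t) (by linarith) (Int.fract_lt_one t).le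
    linarith
  · have h2 := hξ.apply_sub_apply_le_of_mem_Icc hy le_rfl (Int.fract_nonneg t)
      (Int.fract_lt_one t).le
    have h3 := hξ.apply_sub_apply_le_of_mem_Icc hy (Int.fract_nonneg s)
      (Int.fract_lt_one s).le le_rfl
    rw [h1] at h3
    have h4 : (⌊s⌋ : ℝ) + 1 ≤ ⌊t⌋ := by exact_mod_cast h
    linarith

theorem exists_lipschitz (hC : IsConvexNhd C) (hξ : IsPolarLoop C ξ) :
    ∃ K, LipschitzWith K ξ := by
  obtain ⟨R, hR0, hR⟩ := hC.exists_norm_le_gauge_polarSet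
  refine ⟨⟨R, hR0.le⟩, LipschitzWith.of_dist_le_mul fun t s => ?_⟩
  have key : ∀ s t : ℝ, s ≤ t → ‖ξ t - ξ s‖ ≤ R * (t - s) := fun s t hst =>
    (hR _).trans (mul_le_mul_of_nonneg_left (gauge_polarSet_le (sub_nonneg.2 hst) fun y hy =>
      hξ.apply_sub_apply_le hy hst) hR0.le)
  rw [dist_eq_norm, Real.dist_eq]
  change _ ≤ R * _
  rcases le_total s t with h | h
  · rw [abs_of_nonneg (sub_nonneg.2 h)]
    exact key s t h
  · rw [abs_sub_comm, norm_sub_rev, abs_of_nonneg (sub_nonneg.2 h)]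
    exact key t s h

/-- A `C¹` loop with derivative in `Ω⁻¹ C⁰` gives a competitor in the definition of `a_∞(C)`. -/
theorem of_isLoop (S : SymplecticStructure H) {x x' : ℝ → H} (hx : IsLoop x x')
    (h : ∀ t, S.Omega (x' t) ∈ polarSet C) :
    IsPolarLoop C (fun t => S.Omega (x t)) ∧
      S.dualAction (fun t => S.Omega (x t)) = S.loopAction x x' := by
  have hl := hx.map (S.Omega : H →L[ℝ] StrongDual ℝ H)
  refine ⟨⟨hl.periodic, ?_, Filter.Eventually.of_forall fun t => ⟨(hl.hasDerivAt t).differentiableAt,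
    ?_⟩⟩, ?_⟩
  · obtain ⟨M, hM⟩ := (isCompact_Icc (a := (0 : ℝ)) (b := 1)).exists_bound_of_continuousOn
      hl.continuous_deriv.continuousOn
    have hM0 : 0 ≤ M := (norm_nonneg _).trans (hM 0 (by simp))
    refine LipschitzOnWith.absolutelyContinuousOnInterval (K := ⟨M, hM0⟩) ?_
    rw [Set.uIcc_of_le zero_le_one]
    exact (convex_Icc (0 : ℝ) 1).lipschitzOnWith_of_nnnorm_hasDerivWithin_le
      (fun t _ => (hl.hasDerivAt t).hasDerivWithinAt) fun t ht => hM t ht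
  · exact (hl.hasDerivAt t).deriv ▸ h t
  · refine intervalIntegral.integral_congr fun t _ => ?_
    simp only [SymplecticStructure.dualForm]
    erw [(hl.hasDerivAt t).deriv]
    simp

variable [CompleteSpace H]

/-- An upper bound for the action of `C¹` loops extends to absolutely continuous loops, by
averaging over short intervals `[t, t + h]`: this does not take the derivative out of the closed
convex set `C⁰`. -/
theorem dualAction_le (S : SymplecticStructure H) (hC : IsConvexNhd C) (hξ : IsPolarLoop C ξ)
    {a : ℝ} (ha : ∀ x x', IsLoop x x' → (∀ t, S.Omega (x' t) ∈ polarSet C) →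
      S.loopAction x x' ≤ a) : S.dualAction ξ ≤ a := by
  obtain ⟨K, hK⟩ := hξ.exists_lipschitz hC
  set x : ℝ → H := fun t => S.Omega.symm (ξ t) with hx
  have hxK : ∀ s t : ℝ, ‖x t - x s‖ ≤ S.boundSymm * K * |t - s| := fun s t => by
    rw [hx]
    simp only
    rw [← map_sub, mul_assoc]
    exact (S.norm_Omega_symm_le _).trans
      (mul_le_mul_of_nonneg_left (by simpa using hK.norm_sub_le t s) S.boundSymm_nonneg)
  have hxc : Continuous x := S.Omega.symm.continuous.comp hK.continuous
  have hxp : Function.Periodic x 1 := fun t => by simp only [hx, hξ.periodic t]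
  set P : ℝ → H := fun t => ∫ s in (0 : ℝ)..t, x s with hP
  have hPd : ∀ t, HasDerivAt P (x t) t := fun t => intervalIntegral.integral_hasDerivAt_right
    (hxc.intervalIntegrable _ _) (hxc.stronglyMeasurableAtFilter _ _) hxc.continuousAt
  have hPsub : ∀ s t, P t - P s = ∫ r in s..t, x r := fun s t =>
    intervalIntegral.integral_interval_sub_left (hxc.intervalIntegrable _ _)
      (hxc.intervalIntegrable _ _)
  have hloop : ∀ h : ℝ, IsLoop (fun t => h⁻¹ • (P (t + h) - P t))
      (fun t => h⁻¹ • (x (t + h) - x t)) := fun h => by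
    refine ⟨fun t => ?_, fun t => (((hPd (t + h)).comp_add_const t h).sub (hPd t)).const_smul _,
      by fun_prop⟩
    simp only [hPsub]
    have h1 := intervalIntegral.integral_comp_add_right (a := t) (b := t + h) x (1 : ℝ)
    rw [funext hxp, show t + h + 1 = t + 1 + h by ring] at h1
    rw [h1]
  obtain ⟨M, hM0, hM⟩ : ∃ M, 0 ≤ M ∧ ∀ t ∈ Set.Icc (0 : ℝ) 2, ‖x t‖ ≤ M := by
    obtain ⟨M, hM⟩ := (isCompact_Icc (a := (0 : ℝ)) (b := 2)).exists_bound_of_continuousOn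
      hxc.continuousOn
    exact ⟨M, (norm_nonneg _).trans (hM 0 (by simp)), hM⟩
  have hlim : Filter.Tendsto (fun h : ℝ => S.loopAction (fun t => h⁻¹ • (P (t + h) - P t))
      (fun t => h⁻¹ • (x (t + h) - x t))) (𝓝[>] 0) (𝓝 (S.dualAction ξ)) := by
    refine intervalIntegral.tendsto_integral_filter_of_dominated_convergence
      (fun _ => (1 / 2) * (S.bound * (M * (S.boundSymm * K)))) ?_ ?_ intervalIntegrable_const ?_
    · refine Filter.Eventually.of_forall fun h => ?_
      exact (continuous_const.mul (S.continuous_form (hloop h).continuous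
        (hloop h).continuous_deriv)).aestronglyMeasurable
    · filter_upwards [self_mem_nhdsWithin, mem_nhdsWithin_of_mem_nhds
        (gt_mem_nhds (zero_lt_one (α := ℝ)))] with h hh0 hh1
      have hh0 : 0 < h := hh0
      refine Filter.Eventually.of_forall fun t ht => ?_
      rw [Set.uIoc_of_le zero_le_one] at ht
      have b1 : ‖h⁻¹ • (P (t + h) - P t)‖ ≤ M := by
        rw [norm_smul, norm_inv, Real.norm_of_nonneg hh0.le, inv_mul_le_iff₀ hh0, hPsub]
        have := intervalIntegral.norm_integral_le_of_norm_le_const (a := t) (b := t + h)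
          (f := x) (C := M) fun r hr => hM r (by
            rw [Set.uIoc_of_le (by linarith)] at hr
            exact ⟨by linarith [hr.1, ht.1], by linarith [hr.2, ht.2]⟩)
        rw [add_sub_cancel_left, abs_of_pos hh0] at this
        linarith
      have b2 : ‖h⁻¹ • (x (t + h) - x t)‖ ≤ S.boundSymm * K := by
        rw [norm_smul, norm_inv, Real.norm_of_nonneg hh0.le, inv_mul_le_iff₀ hh0]
        have := hxK t (t + h)
        rw [add_sub_cancel_left, abs_of_pos hh0] at this
        linarith
      rw [norm_mul, Real.norm_of_nonneg (by norm_num : (0 : ℝ) ≤ 1 / 2), Real.norm_eq_abs]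
      refine mul_le_mul_of_nonneg_left ((S.abs_form_le _ _).trans ?_) (by norm_num)
      exact mul_le_mul_of_nonneg_left (mul_le_mul b1 b2 (norm_nonneg _) hM0) S.bound_nonneg
    · filter_upwards [hξ.deriv_mem] with t ht
      intro _
      have l1 := (hPd t).tendsto_slope_zero_right
      have hd : HasDerivAt x (S.Omega.symm (deriv ξ t)) t :=
        (S.Omega.symm : StrongDual ℝ H →L[ℝ] H).hasFDerivAt.comp_hasDerivAt t ht.1.hasDerivAt
      have l2 := hd.tendsto_slope_zero_right
      have hc : Continuous fun p : H × H => (1 / 2) * S.form p.1 p.2 :=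
        continuous_const.mul (S.continuous_form continuous_fst continuous_snd)
      have l3 := (hc.tendsto (x t, S.Omega.symm (deriv ξ t))).comp (l1.prodMk_nhds l2)
      simp only [Function.comp_def] at l3
      exact l3
  refine le_of_tendsto hlim ?_
  filter_upwards [self_mem_nhdsWithin] with h hh0
  have hh0 : 0 < h := hh0
  refine ha _ _ (hloop h) fun t y hy => ?_
  have h1 := hξ.apply_sub_apply_le hy (s := t) (t := t + h) (by linarith)
  have h2 : S.Omega (h⁻¹ • (x (t + h) - x t)) y = h⁻¹ * (ξ (t + h) y - ξ t y) := by
    simp [hx]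
  rw [h2, inv_mul_le_iff₀ hh0]
  linarith

end IsPolarLoop

/-! ### The maximal action of `C¹` loops -/

namespace SymplecticStructure

variable {H : Type*} [NormedAddCommGroup H] [InnerProductSpace ℝ H] (S : SymplecticStructure H)

/-- The dual energy `∫ H_{C⁰}(Ω x')` of a loop in `H`. -/
noncomputable def dualEnergy (C : Set H) (x' : ℝ → H) : ℝ :=
  ∫ t in (0 : ℝ)..1, gaugeHamiltonian (polarSet C) (S.Omega (x' t))

/-- The supremum of the action over all `C¹` loops with dual energy at most `1 / 2`. In contrast to
the uniform constraint `ξ' ∈ C⁰`, this constraint is differentiable. -/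
noncomputable def maxAction (C : Set H) : ℝ :=
  sSup {b : ℝ | ∃ x x' : ℝ → H, IsLoop x x' ∧ 2 * S.dualEnergy C x' ≤ 1 ∧ S.loopAction x x' = b}

variable {C : Set H} {x x' : ℝ → H}

theorem dualEnergy_nonneg (C : Set H) (x' : ℝ → H) : 0 ≤ S.dualEnergy C x' :=
  intervalIntegral.integral_nonneg zero_le_one fun _ _ => gaugeHamiltonian_nonneg _

theorem dualEnergy_smul {r : ℝ} (hr : 0 ≤ r) (x' : ℝ → H) :
    S.dualEnergy C (fun t => r • x' t) = r ^ 2 * S.dualEnergy C x' := by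
  rw [dualEnergy, dualEnergy, ← intervalIntegral.integral_const_mul]
  refine intervalIntegral.integral_congr fun t _ => ?_
  simp only [map_smul]
  exact gaugeHamiltonian_smul hr _

theorem _root_.IsConvexNhd.continuous_gaugeHamiltonian_polarSet (hC : IsConvexNhd C) :
    Continuous (gaugeHamiltonian (polarSet C)) := by
  unfold gaugeHamiltonian
  exact continuous_const.mul
    ((continuous_gauge (convex_polarSet C) hC.polarSet_mem_nhds).pow 2)

theorem l2Norm_Omega_sq_le (hC : IsConvexNhd C) {R : ℝ}
    (hR : ∀ ξ : StrongDual ℝ H, ‖ξ‖ ≤ R * gauge (polarSet C) ξ) (hx : Continuous x') :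
    l2Norm (fun t => S.Omega (x' t)) ^ 2 ≤ 2 * R ^ 2 * S.dualEnergy C x' := by
  have hΩ : Continuous fun t => S.Omega (x' t) := S.Omega.continuous.comp hx
  rw [l2Norm_sq, dualEnergy, ← intervalIntegral.integral_const_mul]
  refine intervalIntegral.integral_mono_on zero_le_one
    ((hΩ.norm.pow 2).intervalIntegrable _ _)
    ((continuous_const.mul (hC.continuous_gaugeHamiltonian_polarSet.comp hΩ)).intervalIntegrable
      _ _) fun t _ => ?_
  refine (pow_le_pow_left₀ (norm_nonneg _) (hR _) 2).trans_eq ?_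
  unfold gaugeHamiltonian
  ring

theorem zero_mem_actions (hC : IsConvexNhd C) :
    (0 : ℝ) ∈ {a : ℝ | ∃ ξ : ℝ → StrongDual ℝ H, IsPolarLoop C ξ ∧ S.dualAction ξ = a} := by
  have hl : IsLoop (fun _ : ℝ => (0 : H)) fun _ => 0 :=
    ⟨fun _ => rfl, fun t => hasDerivAt_const t 0, continuous_const⟩
  obtain ⟨h1, h2⟩ := IsPolarLoop.of_isLoop (C := C) S hl fun t => by
    simpa using mem_of_mem_nhds hC.polarSet_mem_nhds
  refine ⟨_, h1, h2.trans ?_⟩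
  simp [loopAction, form]

variable [CompleteSpace H]

theorem exists_loopAction_le_mul_dualEnergy (hC : IsConvexNhd C) :
    ∃ c ≥ 0, ∀ x x' : ℝ → H, IsLoop x x' → S.loopAction x x' ≤ c * S.dualEnergy C x' := by
  obtain ⟨R, hR0, hR⟩ := hC.exists_norm_le_gauge_polarSet
  refine ⟨S.bound * (S.boundSymm ^ 2 * (2 * R ^ 2)), ?_, fun x x' hx => ?_⟩
  · have := S.bound_nonneg
    positivity
  have h1 : l2Norm x' ≤ S.boundSymm * l2Norm fun t => S.Omega (x' t) :=
    l2Norm_le_mul hx.continuous_deriv (S.Omega.continuous.comp hx.continuous_deriv)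
      S.boundSymm_nonneg fun t _ => by simpa using S.norm_Omega_symm_le (S.Omega (x' t))
  have h2 := S.l2Norm_Omega_sq_le hC hR hx.continuous_deriv
  calc S.loopAction x x' ≤ S.bound * l2Norm x' ^ 2 :=
        (le_abs_self _).trans (S.abs_loopAction_le hx)
    _ ≤ S.bound * (S.boundSymm * l2Norm fun t => S.Omega (x' t)) ^ 2 :=
        mul_le_mul_of_nonneg_left (pow_le_pow_left₀ (l2Norm_nonneg _) h1 2) S.bound_nonneg
    _ = S.bound * (S.boundSymm ^ 2 * (l2Norm fun t => S.Omega (x' t)) ^ 2) := by ring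
    _ ≤ S.bound * (S.boundSymm ^ 2 * (2 * R ^ 2 * S.dualEnergy C x')) :=
        mul_le_mul_of_nonneg_left (mul_le_mul_of_nonneg_left h2 (sq_nonneg _)) S.bound_nonneg
    _ = _ := by ring

theorem loopAction_le_maxAction (hC : IsConvexNhd C) (hx : IsLoop x x')
    (h : 2 * S.dualEnergy C x' ≤ 1) : S.loopAction x x' ≤ S.maxAction C := by
  obtain ⟨c, hc0, hc⟩ := S.exists_loopAction_le_mul_dualEnergy hC
  refine le_csSup ⟨c, ?_⟩ ⟨x, x', hx, h, rfl⟩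
  rintro _ ⟨y, y', hy, hy1, rfl⟩
  have := S.dualEnergy_nonneg C y'
  exact (hc y y' hy).trans (mul_le_of_le_one_right hc0 (by linarith))

/-- By homogeneity, the constrained maximization of the action becomes an unconstrained
inequality. -/
theorem loopAction_le_mul_dualEnergy (hC : IsConvexNhd C) (hx : IsLoop x x') :
    S.loopAction x x' ≤ 2 * S.maxAction C * S.dualEnergy C x' := by
  rcases (S.dualEnergy_nonneg C x').eq_or_lt with h0 | h0
  · obtain ⟨c, hc0, hc⟩ := S.exists_loopAction_le_mul_dualEnergy hC
    have := hc x x' hx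
    rw [← h0, mul_zero] at this ⊢
    exact this
  · set r := (√(2 * S.dualEnergy C x'))⁻¹ with hr
    have hr2 : r ^ 2 * (2 * S.dualEnergy C x') = 1 := by
      rw [hr, inv_pow, Real.sq_sqrt (by positivity), inv_mul_cancel₀ (by positivity)]
    have hr0 : 0 ≤ r := by positivity
    have h := S.loopAction_le_maxAction hC (hx.const_smul r) (by
      rw [S.dualEnergy_smul hr0]; linarith)
    rw [S.loopAction_smul] at h
    calc S.loopAction x x' = (r ^ 2 * S.loopAction x x') * (2 * S.dualEnergy C x') := by
          rw [mul_right_comm, hr2, one_mul]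
      _ ≤ S.maxAction C * (2 * S.dualEnergy C x') := mul_le_mul_of_nonneg_right h (by positivity)
      _ = _ := by ring

/-- Absolutely continuous loops with `ξ' ∈ C⁰` do not have larger action than the `C¹` loops of
dual energy at most `1 / 2`. -/
theorem dualAction_le_maxAction (hC : IsConvexNhd C) {ξ : ℝ → StrongDual ℝ H}
    (hξ : IsPolarLoop C ξ) : S.dualAction ξ ≤ S.maxAction C := by
  refine hξ.dualAction_le S hC fun x x' hx h => S.loopAction_le_maxAction hC hx ?_
  have : S.dualEnergy C x' ≤ ∫ _ in (0 : ℝ)..1, (1 / 2 : ℝ) := by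
    refine intervalIntegral.integral_mono_on zero_le_one
      ((hC.continuous_gaugeHamiltonian_polarSet.comp
        (S.Omega.continuous.comp hx.continuous_deriv)).intervalIntegrable _ _)
      intervalIntegrable_const fun t _ => ?_
    have := pow_le_one₀ (n := 2) (gauge_nonneg _) (gauge_le_one_of_mem (h t))
    unfold gaugeHamiltonian
    linarith
  simp only [intervalIntegral.integral_const] at this
  norm_num at this
  linarith

theorem aInfty_le_maxAction (hC : IsConvexNhd C) : aInfty S C ≤ S.maxAction C := by
  refine csSup_le ⟨0, S.zero_mem_actions hC⟩ ?_
  rintro _ ⟨ξ, hξ, rfl⟩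
  exact S.dualAction_le_maxAction hC hξ

theorem dualAction_le_aInfty (hC : IsConvexNhd C) {ξ : ℝ → StrongDual ℝ H}
    (hξ : IsPolarLoop C ξ) : S.dualAction ξ ≤ aInfty S C := by
  refine le_csSup ⟨S.maxAction C, ?_⟩ ⟨ξ, hξ, rfl⟩
  rintro _ ⟨η, hη, rfl⟩
  exact S.dualAction_le_maxAction hC hη

theorem aInfty_nonneg (hC : IsConvexNhd C) : 0 ≤ aInfty S C := by
  obtain ⟨ξ, hξ, h⟩ := S.zero_mem_actions hC
  exact h ▸ S.dualAction_le_aInfty hC hξ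

/-! ### Almost maximizers almost satisfy the Euler–Lagrange equation -/

/-- The operator `J` on `H` with `ω(J g, y) = ⟪g, y⟫`. -/
noncomputable def gradOp : H →L[ℝ] H :=
  LinearMap.mkContinuous
    { toFun := fun g => S.Omega.symm (InnerProductSpace.toDual ℝ H g)
      map_add' := fun g h => by simp
      map_smul' := fun c g => by simp } S.boundSymm fun g => by
        simpa using S.norm_Omega_symm_le (InnerProductSpace.toDual ℝ H g)

theorem Omega_gradOp (g : H) : S.Omega (S.gradOp g) = InnerProductSpace.toDual ℝ H g := by
  simp [gradOp]

theorem norm_gradOp_le (g : H) : ‖S.gradOp g‖ ≤ S.boundSymm * ‖g‖ := by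
  simpa [gradOp] using S.norm_Omega_symm_le (InnerProductSpace.toDual ℝ H g)

/-- The functional `2a ∫ H_{C⁰}(Ω x') - A(x)` is non-negative and has a Lipschitz gradient, so a
step in the direction of the negative gradient shows that the square of the gradient is bounded by
the value. The gradient of this functional of `x'` is represented by `2a X + x`, up to the
constant `m` which accounts for the condition that `x'` has mean zero. -/
theorem exists_gradient_le (hC : IsRegularConvexNhd C) {a : ℝ} (ha0 : 0 ≤ a)
    (ha : ∀ x x' : ℝ → H, IsLoop x x' → S.loopAction x x' ≤ 2 * a * S.dualEnergy C x') :
    ∃ L > 0, ∀ x x' : ℝ → H, IsLoop x x' → ∃ m : H,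
      l2Norm (fun t => (2 * a) • legendre C (S.Omega (x' t)) + x t - m) ^ 2
        ≤ L * (2 * a * S.dualEnergy C x' - S.loopAction x x') := by
  obtain ⟨K, hK⟩ := hC.lipschitz_polar
  have hdiff := hC.contDiff_polar.differentiable one_ne_zero
  set N : ℝ := 2 * a * K + S.bound * S.boundSymm ^ 2 with hN
  have hN0 : 0 ≤ N := by have := S.bound_nonneg; positivity
  refine ⟨4 * (N + 1), by positivity, fun x x' hx => ?_⟩
  have hX : Continuous fun t => legendre C (S.Omega (x' t)) :=
    hC.continuous_legendre.comp (S.Omega.continuous.comp hx.continuous_deriv)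
  have hxc := hx.continuous
  set Y : ℝ → H := fun t => (2 * a) • legendre C (S.Omega (x' t)) + x t with hY
  have hYc : Continuous Y := by fun_prop
  set m : H := ∫ t in (0 : ℝ)..1, Y t with hm
  refine ⟨m, ?_⟩
  set G : ℝ → H := fun t => Y t - m with hG
  have hGc : Continuous G := by fun_prop
  have hG0 : ∫ t in (0 : ℝ)..1, G t = 0 := by
    rw [hG, intervalIntegral.integral_sub (hYc.intervalIntegrable _ _) intervalIntegrable_const]
    simp [hm]
  have hGp : Function.Periodic G 1 := fun t => by
    simp only [hG, hY, hx.periodic t, hx.periodic_deriv t]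
  set s : ℝ := 1 / (2 * (N + 1)) with hs
  have hs0 : 0 < s := by positivity
  have hw := ((IsLoop.of_integral_eq_zero hGc hGp hG0).map S.gradOp).const_smul (-s)
  set w : ℝ → H := fun t => -s • S.gradOp (∫ r in (0 : ℝ)..t, G r)
  set w' : ℝ → H := fun t => -s • S.gradOp (G t) with hw'
  have hΩw : ∀ t, S.Omega (w' t) = -s • InnerProductSpace.toDual ℝ H (G t) := fun t => by
    simp only [hw', map_smul, Omega_gradOp]
  have key := ha _ _ (hx.add hw)
  rw [S.loopAction_add hx hw] at key
  have hG2 : Continuous fun t => ‖G t‖ ^ 2 := hGc.norm.pow 2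
  have hGY : ∫ t in (0 : ℝ)..1, inner ℝ (G t) (Y t) = l2Norm G ^ 2 := by
    have e : ∫ t in (0 : ℝ)..1, inner ℝ m (G t) = 0 := by
      have := (InnerProductSpace.toDual ℝ H m).intervalIntegral_comp_comm
        (hGc.intervalIntegrable (μ := MeasureTheory.volume) 0 1)
      rw [hG0, map_zero] at this
      exact this
    have e' : ∫ t in (0 : ℝ)..1, inner ℝ (G t) (Y t)
        = ∫ t in (0 : ℝ)..1, (‖G t‖ ^ 2 + inner ℝ m (G t)) := by
      refine intervalIntegral.integral_congr fun t _ => ?_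
      have : Y t = G t + m := by simp [hG]
      rw [this, inner_add_right, real_inner_self_eq_norm_sq, real_inner_comm]
    rw [e', intervalIntegral.integral_add (hG2.intervalIntegrable _ _)
      ((continuous_const.inner hGc).intervalIntegrable _ _), e, add_zero, l2Norm_sq]
  have hGxc : Continuous fun t => inner ℝ (G t) (x t) := hGc.inner hxc
  have hGXc : Continuous fun t => inner ℝ (G t) (legendre C (S.Omega (x' t))) := hGc.inner hX
  have e1 : ∫ t in (0 : ℝ)..1, S.form (x t) (w' t) = s * ∫ t in (0 : ℝ)..1, inner ℝ (G t) (x t) := by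
    rw [← intervalIntegral.integral_const_mul]
    refine intervalIntegral.integral_congr fun t _ => ?_
    change S.form (x t) (w' t) = s * inner ℝ (G t) (x t)
    rw [S.form_skew]
    unfold form
    rw [hΩw]
    simp
  have e2 : S.dualEnergy C (fun t => x' t + w' t) ≤ S.dualEnergy C x'
      + (-s) * (∫ t in (0 : ℝ)..1, inner ℝ (G t) (legendre C (S.Omega (x' t))))
      + (K * s ^ 2) * l2Norm G ^ 2 := by
    have cE : ∀ y : ℝ → H, Continuous y → Continuous fun t =>
        gaugeHamiltonian (polarSet C) (S.Omega (y t)) := fun y hy =>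
      hC.contDiff_polar.continuous.comp (S.Omega.continuous.comp hy)
    have c1 := cE _ hx.continuous_deriv
    have c2 := cE _ (hx.continuous_deriv.fun_add hw.continuous_deriv)
    rw [l2Norm_sq, dualEnergy, dualEnergy, ← intervalIntegral.integral_const_mul,
      ← intervalIntegral.integral_const_mul,
      ← intervalIntegral.integral_add (c1.intervalIntegrable _ _)
        ((hGXc.const_mul _).intervalIntegrable _ _),
      ← intervalIntegral.integral_add
        ((c1.fun_add (hGXc.const_mul _)).intervalIntegrable _ _)
        ((hG2.const_mul _).intervalIntegrable _ _)]
    refine intervalIntegral.integral_mono_on zero_le_one (c2.intervalIntegrable _ _)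
      (((c1.fun_add (hGXc.const_mul _)).fun_add (hG2.const_mul _)).intervalIntegrable _ _) fun t _ => ?_
    have h := (abs_le.1 (abs_sub_sub_fderiv_le hdiff hK (S.Omega (x' t)) (S.Omega (w' t)))).2
    rw [← apply_legendre, hΩw, ← hΩw, ← map_add, hΩw, norm_smul, LinearIsometryEquiv.norm_map,
      norm_neg, Real.norm_of_nonneg hs0.le, smul_apply,
      InnerProductSpace.toDual_apply_apply, smul_eq_mul] at h
    linarith
  have e3 : |S.loopAction w w'| ≤ S.bound * S.boundSymm ^ 2 * s ^ 2 * l2Norm G ^ 2 := by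
    have h1 : l2Norm w' ≤ (s * S.boundSymm) * l2Norm G :=
      l2Norm_le_mul hw.continuous_deriv hGc (mul_nonneg hs0.le S.boundSymm_nonneg) fun t _ => by
        simp only [hw']
        rw [norm_smul, norm_neg, Real.norm_of_nonneg hs0.le, mul_assoc]
        exact mul_le_mul_of_nonneg_left (S.norm_gradOp_le _) hs0.le
    calc |S.loopAction w w'| ≤ S.bound * l2Norm w' ^ 2 := S.abs_loopAction_le hw
      _ ≤ S.bound * ((s * S.boundSymm) * l2Norm G) ^ 2 :=
        mul_le_mul_of_nonneg_left (pow_le_pow_left₀ (l2Norm_nonneg _) h1 2) S.bound_nonneg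
      _ = _ := by ring
  have e4 : 2 * a * (∫ t in (0 : ℝ)..1, inner ℝ (G t) (legendre C (S.Omega (x' t))))
      + ∫ t in (0 : ℝ)..1, inner ℝ (G t) (x t) = l2Norm G ^ 2 := by
    rw [← hGY, ← intervalIntegral.integral_const_mul, ← intervalIntegral.integral_add
      ((hGXc.const_mul _).intervalIntegrable _ _) (hGxc.intervalIntegrable _ _)]
    refine intervalIntegral.integral_congr fun t _ => ?_
    simp only [hY, inner_add_right, inner_smul_right]
  rw [e1] at key
  have e5 := mul_le_mul_of_nonneg_left e2 (by positivity : 0 ≤ 2 * a)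
  have e6 := (abs_le.1 e3).1
  have e7 : 0 ≤ (2 * a * S.dualEnergy C x' - S.loopAction x x') - s * l2Norm G ^ 2
      + s ^ 2 * N * l2Norm G ^ 2 := by
    rw [← e4] at e5 e6 ⊢
    rw [hN]
    linarith
  -- the choice of `s` makes the quadratic term at most half of the linear one
  have e8 : s * N ≤ 1 / 2 := by
    rw [hs, one_div, inv_mul_le_iff₀ (by positivity)]
    linarith
  have e9 : s * (4 * (N + 1)) = 2 := by rw [hs]; field_simp; norm_num
  have e10 : s * l2Norm G ^ 2 ≤ 2 * (2 * a * S.dualEnergy C x' - S.loopAction x x') := by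
    have := mul_le_mul_of_nonneg_right e8 (mul_nonneg hs0.le (sq_nonneg (l2Norm G)))
    nlinarith
  have e11 : s * l2Norm G ^ 2
      ≤ s * (4 * (N + 1) * (2 * a * S.dualEnergy C x' - S.loopAction x x')) := by
    rw [← mul_assoc, e9]
    exact e10
  exact le_of_mul_le_mul_left e11 hs0

end SymplecticStructure

/-! ### Approximate closed characteristics -/

namespace SymplecticStructure

variable {H : Type*} [NormedAddCommGroup H] [InnerProductSpace ℝ H]

/-- A loop `u` which solves the Hamiltonian system `2a Ω u' + dH_C(u) = 0` up to an error of `ε` in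
`L²`, whose energy is uniformly `ε`-close to `1 / 2`, and whose action, rescaled, is at least
`a - ε`. In infinite dimensions an exact solution need not exist. -/
structure IsApproxCharacteristic (S : SymplecticStructure H) (C : Set H) (a ε : ℝ)
    (u u' : ℝ → H) : Prop where
  isLoop : IsLoop u u'
  defect : l2Norm (fun t => (2 * a) • S.Omega (u' t) + fderiv ℝ (gaugeHamiltonian C) (u t)) ≤ ε
  energy : ∀ t, |gaugeHamiltonian C (u t) - 1 / 2| ≤ ε
  action : a - ε ≤ (2 * a) ^ 2 * S.loopAction u u'

variable (S : SymplecticStructure H) {C : Set H}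

/-- The energy is almost conserved along an approximate solution, since the exact Hamiltonian vector
field is tangent to the level sets. -/
theorem abs_gaugeHamiltonian_sub_le (hC : IsRegularConvexNhd C) {a : ℝ} (ha : 0 < a)
    {u u' : ℝ → H} (hu : IsLoop u u') {t : ℝ} (ht : t ∈ Set.Icc (0 : ℝ) 1) :
    |gaugeHamiltonian C (u t) - gaugeHamiltonian C (u 0)| ≤ (2 * a)⁻¹ * S.boundSymm *
      (l2Norm (fun t => fderiv ℝ (gaugeHamiltonian C) (u t)) *
        l2Norm fun t => (2 * a) • S.Omega (u' t) + fderiv ℝ (gaugeHamiltonian C) (u t)) := by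
  have hdiff := hC.contDiff.differentiable one_ne_zero
  have hcd : Continuous fun t => fderiv ℝ (gaugeHamiltonian C) (u t) :=
    (hC.contDiff.continuous_fderiv one_ne_zero).comp hu.continuous
  set p : ℝ → StrongDual ℝ H := fun t => fderiv ℝ (gaugeHamiltonian C) (u t) with hp
  set d : ℝ → StrongDual ℝ H := fun t => (2 * a) • S.Omega (u' t) + p t with hd
  have hdc : Continuous d :=
    ((S.Omega.continuous.comp hu.continuous_deriv).const_smul (2 * a)).add hcd
  have hl : IsLoop (fun t => gaugeHamiltonian C (u t)) fun t => p t (u' t) :=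
    ⟨fun t => by simp only [hu.periodic t], fun t =>
      (hdiff (u t)).hasFDerivAt.comp_hasDerivAt t (hu.hasDerivAt t),
      hcd.clm_apply hu.continuous_deriv⟩
  have hbd : ∀ t, ‖p t (u' t)‖ ≤ (2 * a)⁻¹ * S.boundSymm * (‖p t‖ * ‖d t‖) := fun t => by
    have e1 : p t (S.Omega.symm (p t)) = 0 := by
      have := S.form_self (S.Omega.symm (p t))
      simpa [form] using this
    have e2 : p t (u' t) = (2 * a)⁻¹ * p t (S.Omega.symm (d t)) := by
      simp only [hd, map_add, map_smul, ContinuousLinearEquiv.symm_apply_apply, e1, smul_eq_mul]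
      field_simp
      ring
    rw [e2, norm_mul, Real.norm_of_nonneg (by positivity), mul_assoc]
    refine mul_le_mul_of_nonneg_left (((p t).le_opNorm _).trans ?_) (by positivity)
    calc ‖p t‖ * ‖S.Omega.symm (d t)‖ ≤ ‖p t‖ * (S.boundSymm * ‖d t‖) :=
          mul_le_mul_of_nonneg_left (S.norm_Omega_symm_le _) (norm_nonneg _)
      _ = _ := by ring
  have hc0 : 0 ≤ (2 * a)⁻¹ * S.boundSymm := mul_nonneg (by positivity) S.boundSymm_nonneg
  calc |gaugeHamiltonian C (u t) - gaugeHamiltonian C (u 0)|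
      ≤ ∫ s in (0 : ℝ)..1, ‖p s (u' s)‖ := hl.norm_sub_le_integral ht
    _ ≤ ∫ s in (0 : ℝ)..1, (2 * a)⁻¹ * S.boundSymm * (‖p s‖ * ‖d s‖) :=
        intervalIntegral.integral_mono_on zero_le_one
          (hl.continuous_deriv.norm.intervalIntegrable _ _)
          (((hcd.norm.mul hdc.norm).const_mul _).intervalIntegrable _ _) fun s _ => hbd s
    _ = (2 * a)⁻¹ * S.boundSymm * ∫ s in (0 : ℝ)..1, ‖p s‖ * ‖d s‖ :=
        intervalIntegral.integral_const_mul _ _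
    _ ≤ _ := mul_le_mul_of_nonneg_left (integral_norm_mul_norm_le hcd hdc) hc0

theorem abs_sub_integral_le_of_abs_sub_le {h : ℝ → ℝ} (hc : Continuous h) {q : ℝ}
    (hq : ∀ t ∈ Set.Icc (0 : ℝ) 1, |h t - h 0| ≤ q) {t : ℝ} (ht : t ∈ Set.Icc (0 : ℝ) 1) :
    |h t - ∫ s in (0 : ℝ)..1, h s| ≤ 2 * q := by
  have h1 : |(∫ s in (0 : ℝ)..1, h s) - h 0| ≤ q := by
    have := intervalIntegral.norm_integral_le_of_norm_le_const (a := 0) (b := 1)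
      (f := fun s => h s - h 0) (C := q) fun s hs => hq s (by
        rw [Set.uIoc_of_le zero_le_one] at hs; exact ⟨hs.1.le, hs.2⟩)
    rw [intervalIntegral.integral_sub (hc.intervalIntegrable _ _) intervalIntegrable_const] at this
    simpa using this
  have h2 := abs_le.1 (hq t ht)
  have h3 := abs_le.1 h1
  rw [abs_le]
  constructor <;> linarith [h2.1, h2.2, h3.1, h3.2]

variable [CompleteSpace H]

/-- Loops of almost maximal action yield approximate closed characteristics: if `x` almost maximizes
the action, then `u = (m - x) / 2a` is close in `L²` to the Legendre transform of `Ω x'`. -/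
theorem exists_isApproxCharacteristic (hC : IsRegularConvexNhd C) (ha : 0 < S.maxAction C) {ε : ℝ}
    (hε : 0 < ε) : ∃ u u', S.IsApproxCharacteristic C (S.maxAction C) ε u u' := by
  set a := S.maxAction C with ha_def
  obtain ⟨L, hL0, hL⟩ := S.exists_gradient_le hC ha.le
    fun x x' hx => S.loopAction_le_mul_dualEnergy hC.toIsConvexNhd hx
  obtain ⟨R, hR0, hR⟩ := hC.exists_norm_le_gauge_polarSet
  obtain ⟨K, hK⟩ := hC.lipschitz
  have hdiff := hC.contDiff.differentiable one_ne_zero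
  have hcd := hC.contDiff.continuous_fderiv one_ne_zero
  set κ : ℝ := (2 * a)⁻¹ * √L with hκ
  have hκ0 : 0 ≤ κ := by positivity
  -- `δ` is the square root of the deficit of the action; these bound the errors that it causes
  set errH : ℝ → ℝ := fun δ => 2 * ((2 * a)⁻¹ * S.boundSymm * ((K * (κ * δ) + R) * (K * (κ * δ))))
    + (R * (κ * δ) + K * (κ * δ) ^ 2) + δ ^ 2 / (2 * a) with herrH
  obtain ⟨δ, hδ0, hδ1, hδ2, hδ3⟩ : ∃ δ > 0, errH δ ≤ ε ∧ K * (κ * δ) ≤ ε ∧ δ ^ 2 ≤ ε := by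
    have c1 : Filter.Tendsto errH (𝓝[>] 0) (𝓝 0) :=
      ((by fun_prop : Continuous errH).tendsto' 0 0 (by simp [herrH])).mono_left
        nhdsWithin_le_nhds
    have c2 : Filter.Tendsto (fun δ : ℝ => K * (κ * δ)) (𝓝[>] 0) (𝓝 0) :=
      (Continuous.tendsto' (by fun_prop) 0 0 (by simp)).mono_left nhdsWithin_le_nhds
    have c3 : Filter.Tendsto (fun δ : ℝ => δ ^ 2) (𝓝[>] 0) (𝓝 0) :=
      (Continuous.tendsto' (by fun_prop) 0 0 (by simp)).mono_left nhdsWithin_le_nhds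
    obtain ⟨δ, h0, h1, h2, h3⟩ := (eventually_mem_nhdsWithin.and ((c1.eventually_le_const hε).and
      ((c2.eventually_le_const hε).and (c3.eventually_le_const hε)))).exists
    exact ⟨δ, h0, h1, h2, h3⟩
  obtain ⟨_, ⟨x, x', hx, hx1, rfl⟩, hxa⟩ : ∃ b ∈ {b : ℝ | ∃ x x' : ℝ → H, IsLoop x x' ∧
      2 * S.dualEnergy C x' ≤ 1 ∧ S.loopAction x x' = b}, a - δ ^ 2 < b := by
    refine exists_lt_of_lt_csSup ?_ (sub_lt_self _ (by positivity))
    -- the real supremum of the empty set is `0`, which is excluded by `0 < a`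
    by_contra hne
    rw [Set.not_nonempty_iff_eq_empty] at hne
    rw [ha_def, maxAction, hne, Real.sSup_empty] at ha
    exact lt_irrefl _ ha
  set E := S.dualEnergy C x' with hE
  obtain ⟨m, hm⟩ := hL x x' hx
  have hxc := hx.continuous
  have hΩc : Continuous fun t => S.Omega (x' t) := S.Omega.continuous.comp hx.continuous_deriv
  set X : ℝ → H := fun t => legendre C (S.Omega (x' t)) with hXdef
  have hXc : Continuous X := hC.continuous_legendre.comp hΩc
  have hGδ : l2Norm (fun t => (2 * a) • X t + x t - m) ≤ √L * δ := by
    refine abs_le_of_sq_le_sq' ?_ (by positivity) |>.2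
    rw [mul_pow, Real.sq_sqrt hL0.le]
    refine hm.trans (mul_le_mul_of_nonneg_left ?_ hL0.le)
    have : 2 * a * E ≤ a := by nlinarith
    linarith
  set u : ℝ → H := fun t => (2 * a)⁻¹ • (m + (-1 : ℝ) • x t) with hudef
  set u' : ℝ → H := fun t => (2 * a)⁻¹ • ((-1 : ℝ) • x' t) with hu'def
  have hu : IsLoop u u' := ((hx.const_smul (-1)).const_add m).const_smul _
  have huc := hu.continuous
  have huX : ∀ t, u t - X t = -((2 * a)⁻¹ • ((2 * a) • X t + x t - m)) := fun t => by
    have : (2 * a)⁻¹ • ((2 * a) • X t) = X t := by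
      rw [smul_smul, inv_mul_cancel₀ (by positivity), one_smul]
    simp only [hudef, smul_add, smul_sub, this, neg_smul, one_smul, smul_neg]
    abel
  have hl2 : l2Norm (fun t => u t - X t) ≤ κ * δ := by
    have h1 : l2Norm (fun t => u t - X t) ≤ (2 * a)⁻¹ * l2Norm fun t =>
        (2 * a) • X t + x t - m := by
      refine l2Norm_le_mul (huc.fun_sub hXc) (by fun_prop) (by positivity) fun t _ => ?_
      rw [huX, norm_neg, norm_smul, Real.norm_of_nonneg (by positivity)]
    refine h1.trans ?_
    rw [hκ, mul_assoc]
    exact mul_le_mul_of_nonneg_left hGδ (by positivity)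
  have hΩu : ∀ t, (2 * a) • S.Omega (u' t) = -S.Omega (x' t) := fun t => by
    simp only [hu'def, map_smul]
    rw [smul_smul, mul_inv_cancel₀ (by positivity), one_smul]
    exact neg_one_smul ℝ (S.Omega (x' t))
  have hpX : ∀ t, fderiv ℝ (gaugeHamiltonian C) (X t) = S.Omega (x' t) := fun t =>
    hC.fderiv_legendre _
  have hpc : Continuous fun t => fderiv ℝ (gaugeHamiltonian C) (u t) := hcd.comp huc
  have hdc : Continuous fun t => (2 * a) • S.Omega (u' t)
      + fderiv ℝ (gaugeHamiltonian C) (u t) :=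
    ((S.Omega.continuous.comp hu.continuous_deriv).const_smul (2 * a)).add hpc
  have hdefect : l2Norm (fun t => (2 * a) • S.Omega (u' t)
      + fderiv ℝ (gaugeHamiltonian C) (u t)) ≤ K * (κ * δ) := by
    refine (l2Norm_le_mul hdc (huc.fun_sub hXc) K.2 fun t _ => ?_).trans
      (mul_le_mul_of_nonneg_left hl2 K.2)
    rw [hΩu, ← hpX, neg_add_eq_sub]
    exact hK.norm_sub_le _ _
  have hΩl2 : l2Norm (fun t => S.Omega (x' t)) ≤ R := by
    refine abs_le_of_sq_le_sq' ?_ hR0.le |>.2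
    have := S.l2Norm_Omega_sq_le hC.toIsConvexNhd hR hx.continuous_deriv
    nlinarith [sq_nonneg R]
  have hpl2 : l2Norm (fun t => fderiv ℝ (gaugeHamiltonian C) (u t)) ≤ K * (κ * δ) + R := by
    have h1 := l2Norm_add_le hdc hΩc
    simp only [hΩu, neg_add_eq_sub, sub_add_cancel] at h1
    simp only [hΩu, neg_add_eq_sub] at hdefect
    linarith
  have hHc : Continuous fun t => gaugeHamiltonian C (u t) := hC.contDiff.continuous.comp huc
  have hHXc : Continuous fun t => gaugeHamiltonian C (X t) := hC.contDiff.continuous.comp hXc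
  have hmean : |(∫ t in (0 : ℝ)..1, gaugeHamiltonian C (u t)) - E|
      ≤ R * (κ * δ) + K * (κ * δ) ^ 2 := by
    have hEX : E = ∫ t in (0 : ℝ)..1, gaugeHamiltonian C (X t) :=
      intervalIntegral.integral_congr fun t _ => (hC.gaugeHamiltonian_legendre _).symm
    have hvc : Continuous fun t => u t - X t := huc.sub hXc
    have hv2 : Continuous fun t => ‖u t - X t‖ ^ 2 := hvc.norm.pow 2
    have hpv : Continuous fun t => ‖S.Omega (x' t)‖ * ‖u t - X t‖ := hΩc.norm.mul hvc.norm
    rw [hEX, ← intervalIntegral.integral_sub (hHc.intervalIntegrable _ _)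
      (hHXc.intervalIntegrable _ _)]
    refine (intervalIntegral.abs_integral_le_integral_abs zero_le_one).trans ?_
    calc ∫ t in (0 : ℝ)..1, |gaugeHamiltonian C (u t) - gaugeHamiltonian C (X t)|
        ≤ ∫ t in (0 : ℝ)..1, (‖S.Omega (x' t)‖ * ‖u t - X t‖ + K * ‖u t - X t‖ ^ 2) := by
          refine intervalIntegral.integral_mono_on zero_le_one
            ((hHc.sub hHXc).abs.intervalIntegrable _ _)
            ((hpv.fun_add (hv2.const_mul _)).intervalIntegrable _ _) fun t _ => ?_
          have h1 := abs_sub_sub_fderiv_le hdiff hK (X t) (u t - X t)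
          rw [add_sub_cancel, hpX] at h1
          have h2 : |S.Omega (x' t) (u t - X t)| ≤ ‖S.Omega (x' t)‖ * ‖u t - X t‖ :=
            (S.Omega (x' t)).le_opNorm _
          have h3 := abs_le.1 h1
          have h4 := abs_le.1 h2
          rw [abs_le]
          constructor <;> linarith [h3.1, h3.2, h4.1, h4.2]
      _ = (∫ t in (0 : ℝ)..1, ‖S.Omega (x' t)‖ * ‖u t - X t‖)
            + K * l2Norm (fun t => u t - X t) ^ 2 := by
          rw [intervalIntegral.integral_add (hpv.intervalIntegrable _ _)
            ((hv2.const_mul _).intervalIntegrable _ _), intervalIntegral.integral_const_mul,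
            l2Norm_sq]
      _ ≤ R * (κ * δ) + K * (κ * δ) ^ 2 := by
          refine add_le_add ((integral_norm_mul_norm_le hΩc hvc).trans
            (mul_le_mul hΩl2 hl2 (l2Norm_nonneg _) hR0.le)) ?_
          exact mul_le_mul_of_nonneg_left (pow_le_pow_left₀ (l2Norm_nonneg _) hl2 2) K.2
  have hE1 : |E - 1 / 2| ≤ δ ^ 2 / (2 * a) := by
    have h1 := S.loopAction_le_mul_dualEnergy hC.toIsConvexNhd hx
    have h2 : 1 / 2 - δ ^ 2 / (2 * a) ≤ E := by
      have : 1 / 2 - δ ^ 2 / (2 * a) = (a - δ ^ 2) / (2 * a) := by field_simp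
      rw [this, div_le_iff₀ (by positivity)]
      linarith
    have h3 : 0 ≤ δ ^ 2 / (2 * a) := by positivity
    rw [abs_le]
    constructor <;> linarith
  refine ⟨u, u', hu, hdefect.trans hδ2, ?_, ?_⟩
  · have key : ∀ t ∈ Set.Icc (0 : ℝ) 1, |gaugeHamiltonian C (u t) - 1 / 2| ≤ ε := fun t ht => by
      have h1 := abs_sub_integral_le_of_abs_sub_le hHc (fun s hs =>
        (S.abs_gaugeHamiltonian_sub_le hC ha hu hs).trans (mul_le_mul_of_nonneg_left
          (mul_le_mul hpl2 hdefect (l2Norm_nonneg _) ((l2Norm_nonneg _).trans hpl2))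
          (mul_nonneg (by positivity) S.boundSymm_nonneg))) ht
      refine le_trans ?_ hδ1
      have h2 := abs_le.1 h1
      have h3 := abs_le.1 hmean
      have h4 := abs_le.1 hE1
      rw [abs_le, herrH]
      constructor <;> linarith [h2.1, h2.2, h3.1, h3.2, h4.1, h4.2]
    intro t
    have := hu.periodic.sub_int_mul_eq (x := t) ⌊t⌋
    rw [mul_one, Int.self_sub_floor] at this
    rw [← this]
    exact key _ ⟨Int.fract_nonneg t, (Int.fract_lt_one t).le⟩
  · have h1 : S.loopAction u u' = ((2 * a)⁻¹) ^ 2 * S.loopAction x x' := by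
      rw [hudef, hu'def, S.loopAction_smul,
        S.loopAction_const_add m (hx.const_smul (-1)), S.loopAction_smul]
      norm_num
    rw [h1, ← mul_assoc, ← mul_pow, mul_inv_cancel₀ (by positivity), one_pow, one_mul]
    linarith

end SymplecticStructure

/-! ### Homogeneous symplectomorphisms -/

namespace IsHomogeneousSymplectomorphism

variable {H : Type*} [NormedAddCommGroup H] [InnerProductSpace ℝ H] {S : SymplecticStructure H}
  {ψ : H ≃ H} {C : Set H}

theorem map_ne_zero (hψ : IsHomogeneousSymplectomorphism S ψ) {x : H} (hx : x ≠ 0) : ψ x ≠ 0 :=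
  fun h => hx (ψ.injective (h.trans hψ.map_zero.symm))

theorem symm_map_zero (hψ : IsHomogeneousSymplectomorphism S ψ) : ψ.symm 0 = 0 :=
  ψ.symm_apply_eq.2 hψ.map_zero.symm

theorem symm_map_ne_zero (hψ : IsHomogeneousSymplectomorphism S ψ) {x : H} (hx : x ≠ 0) :
    ψ.symm x ≠ 0 :=
  fun h => hx (ψ.symm.injective (h.trans hψ.symm_map_zero.symm))

theorem differentiableAt (hψ : IsHomogeneousSymplectomorphism S ψ) {x : H} (hx : x ≠ 0) :
    DifferentiableAt ℝ ψ x :=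
  (hψ.contDiffOn.differentiableOn one_ne_zero).differentiableAt
    (isOpen_compl_singleton.mem_nhds hx)

theorem differentiableAt_symm (hψ : IsHomogeneousSymplectomorphism S ψ) {x : H} (hx : x ≠ 0) :
    DifferentiableAt ℝ ψ.symm x :=
  (hψ.contDiffOn_symm.differentiableOn one_ne_zero).differentiableAt
    (isOpen_compl_singleton.mem_nhds hx)

theorem fderiv_fderiv_symm (hψ : IsHomogeneousSymplectomorphism S ψ) {x : H} (hx : x ≠ 0)
    (v : H) : fderiv ℝ ψ x (fderiv ℝ ψ.symm (ψ x) v) = v := by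
  have h1 : HasFDerivAt ψ (fderiv ℝ ψ x) (ψ.symm (ψ x)) := by
    rw [ψ.symm_apply_apply]; exact (hψ.differentiableAt hx).hasFDerivAt
  have h2 := h1.comp (ψ x) (hψ.differentiableAt_symm (hψ.map_ne_zero hx)).hasFDerivAt
  rw [ψ.self_comp_symm] at h2
  exact DFunLike.congr_fun (h2.unique (hasFDerivAt_id (ψ x))) v

/-- Euler's identity for the `1`-homogeneous map `ψ`. -/
theorem fderiv_self (hψ : IsHomogeneousSymplectomorphism S ψ) {x : H} (hx : x ≠ 0) :
    fderiv ℝ ψ x x = ψ x := by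
  have hline : HasDerivAt (fun s : ℝ => s • x) x 1 := by
    simpa using (hasDerivAt_id (1 : ℝ)).smul_const x
  have h1 : HasDerivAt (fun s : ℝ => ψ (s • x)) (fderiv ℝ ψ x x) 1 :=
    HasFDerivAt.comp_hasDerivAt (l := ψ) (1 : ℝ)
      (by simpa using (hψ.differentiableAt hx).hasFDerivAt) hline
  have h2 : HasDerivAt (fun s : ℝ => s • ψ x) (ψ x) 1 := by
    simpa using (hasDerivAt_id (1 : ℝ)).smul_const (ψ x)
  refine h1.unique (h2.congr_of_eventuallyEq ?_)
  filter_upwards [lt_mem_nhds (zero_lt_one (α := ℝ))] with s hs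
  exact hψ.homogeneous x s hs

theorem symm (hψ : IsHomogeneousSymplectomorphism S ψ) :
    IsHomogeneousSymplectomorphism S ψ.symm where
  map_zero := hψ.symm_map_zero
  contDiffOn := hψ.contDiffOn_symm
  contDiffOn_symm := hψ.contDiffOn
  symplectic y hy u v := by
    have hx := hψ.symm_map_ne_zero hy
    have h := hψ.symplectic _ hx (fderiv ℝ ψ.symm y u) (fderiv ℝ ψ.symm y v)
    have h1 := hψ.fderiv_fderiv_symm hx u
    have h2 := hψ.fderiv_fderiv_symm hx v
    rw [ψ.apply_symm_apply] at h1 h2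
    rw [h1, h2] at h
    exact h.symm
  homogeneous y t ht := by
    rw [ψ.symm_apply_eq, hψ.homogeneous _ t ht, ψ.apply_symm_apply]

theorem gauge_image (hψ : IsHomogeneousSymplectomorphism S ψ) (x : H) :
    gauge (ψ '' C) (ψ x) = gauge C x := by
  rw [gauge_def', gauge_def']
  congr 1
  ext r
  refine and_congr_right fun hr => ?_
  have hr : 0 < r := hr
  rw [← hψ.homogeneous x _ (inv_pos.2 hr), ψ.injective.mem_set_image]

theorem gaugeHamiltonian_image (hψ : IsHomogeneousSymplectomorphism S ψ) (x : H) :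
    gaugeHamiltonian (ψ '' C) (ψ x) = gaugeHamiltonian C x := by
  unfold gaugeHamiltonian
  rw [hψ.gauge_image]

/-- `ψ` maps approximate closed characteristics of `C` to those of `ψ(C)`: it intertwines the
Hamiltonians, and by Euler's identity it preserves the Liouville form pointwise. -/
theorem isApproxCharacteristic_image (hψ : IsHomogeneousSymplectomorphism S ψ) {M : ℝ}
    (hM1 : 1 ≤ M) (hM : ∀ x : H, x ≠ 0 → ‖fderiv ℝ ψ.symm x‖ ≤ M) (hC : IsRegularConvexNhd C)
    (hψC : IsRegularConvexNhd (ψ '' C)) {a ε : ℝ} (hε : ε < 1 / 2) {u u' : ℝ → H}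
    (hu : S.IsApproxCharacteristic C a ε u u') :
    S.IsApproxCharacteristic (ψ '' C) a (M * ε) (fun t => ψ (u t))
      (fun t => fderiv ℝ ψ (u t) (u' t)) := by
  have hε0 : 0 ≤ ε := (l2Norm_nonneg _).trans hu.defect
  have hεM : ε ≤ M * ε := le_mul_of_one_le_left hε0 hM1
  have hu0 : ∀ t, u t ≠ 0 := fun t h => by
    have := hu.energy t
    rw [h, gaugeHamiltonian, gauge_zero, abs_le] at this
    linarith [this.1]
  have hloop : IsLoop (fun t => ψ (u t)) (fun t => fderiv ℝ ψ (u t) (u' t)) := by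
    refine ⟨fun t => by simp only [hu.isLoop.periodic t], fun t =>
      (hψ.differentiableAt (hu0 t)).hasFDerivAt.comp_hasDerivAt t (hu.isLoop.hasDerivAt t), ?_⟩
    have hc := hψ.contDiffOn.continuousOn_fderiv_of_isOpen isOpen_compl_singleton le_rfl
    exact (hc.comp_continuous hu.isLoop.continuous hu0).clm_apply hu.isLoop.continuous_deriv
  refine ⟨hloop, ?_, fun t => ?_, ?_⟩
  · have hd : Continuous fun t => (2 * a) • S.Omega (u' t)
        + fderiv ℝ (gaugeHamiltonian C) (u t) :=
      ((S.Omega.continuous.comp hu.isLoop.continuous_deriv).const_smul (2 * a)).add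
        ((hC.contDiff.continuous_fderiv one_ne_zero).comp hu.isLoop.continuous)
    have he : Continuous fun t => (2 * a) • S.Omega (fderiv ℝ ψ (u t) (u' t))
        + fderiv ℝ (gaugeHamiltonian (ψ '' C)) (ψ (u t)) :=
      ((S.Omega.continuous.comp hloop.continuous_deriv).const_smul (2 * a)).add
        ((hψC.contDiff.continuous_fderiv one_ne_zero).comp hloop.continuous)
    refine (l2Norm_le_mul he hd (zero_le_one.trans hM1) fun t _ => ?_).trans
      (mul_le_mul_of_nonneg_left hu.defect (zero_le_one.trans hM1))
    have hchain : fderiv ℝ (gaugeHamiltonian C) (u t)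
        = (fderiv ℝ (gaugeHamiltonian (ψ '' C)) (ψ (u t))).comp (fderiv ℝ ψ (u t)) := by
      have h := ((hψC.contDiff.differentiable one_ne_zero _).hasFDerivAt).comp (u t)
        (hψ.differentiableAt (hu0 t)).hasFDerivAt
      have h2 : gaugeHamiltonian (ψ '' C) ∘ ψ = gaugeHamiltonian C :=
        funext hψ.gaugeHamiltonian_image
      rw [h2] at h
      exact h.fderiv
    refine ContinuousLinearMap.opNorm_le_bound _ (by positivity) fun v => ?_
    -- both summands of the defect at `ψ (u t)` are the pullbacks by `dψ⁻¹` of those at `u t`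
    have h1 := hψ.fderiv_fderiv_symm (hu0 t) v
    set w := fderiv ℝ ψ.symm (ψ (u t)) v with hw
    have h2 : ((2 * a) • S.Omega (fderiv ℝ ψ (u t) (u' t))
        + fderiv ℝ (gaugeHamiltonian (ψ '' C)) (ψ (u t))) v
        = ((2 * a) • S.Omega (u' t) + fderiv ℝ (gaugeHamiltonian C) (u t)) w := by
      have h3 := hψ.symplectic (u t) (hu0 t) (u' t) w
      unfold SymplecticStructure.form at h3
      rw [← h1, hchain]
      simp only [add_apply, smul_apply, ContinuousLinearMap.comp_apply, h3]
    rw [h2]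
    refine (ContinuousLinearMap.le_opNorm _ w).trans ?_
    have h4 : ‖w‖ ≤ M * ‖v‖ := (ContinuousLinearMap.le_opNorm _ v).trans
      (mul_le_mul_of_nonneg_right (hM _ (hψ.map_ne_zero (hu0 t))) (norm_nonneg v))
    refine (mul_le_mul_of_nonneg_left h4 (norm_nonneg _)).trans_eq ?_
    ring
  · rw [hψ.gaugeHamiltonian_image]
    exact (hu.energy t).trans hεM
  · have : S.loopAction (fun t => ψ (u t)) (fun t => fderiv ℝ ψ (u t) (u' t))
        = S.loopAction u u' := by
      refine intervalIntegral.integral_congr fun t _ => ?_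
      change 1 / 2 * S.form (ψ (u t)) (fderiv ℝ ψ (u t) (u' t)) = 1 / 2 * S.form (u t) (u' t)
      rw [← hψ.fderiv_self (hu0 t), hψ.symplectic _ (hu0 t)]
    rw [this]
    linarith [hu.action]

end IsHomogeneousSymplectomorphism

/-! ### From approximate closed characteristics back to `a_∞` -/

namespace SymplecticStructure

variable {H : Type*} [NormedAddCommGroup H] [InnerProductSpace ℝ H] [CompleteSpace H]
  (S : SymplecticStructure H) {C : Set H}

/-- Along an approximate closed characteristic `u`, the covector `dH_C(u)` has gauge close to `1`
*uniformly*. Subtracting its small mean and integrating gives a loop which is almost admissible for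
`a_∞(C)` and whose action is close to the one of `2a Ω u`. -/
theorem le_aInfty_of_isApproxCharacteristic (hC : IsRegularConvexNhd C) {a : ℝ}
    (h : ∀ ε > 0, ∃ u u', S.IsApproxCharacteristic C a ε u u') : a ≤ aInfty S C := by
  obtain ⟨R, hR0, hR⟩ := hC.exists_gauge_polarSet_le
  obtain ⟨R', hR'0, hR'⟩ := hC.exists_norm_le_gauge_polarSet
  have hdiff := hC.contDiff.differentiable one_ne_zero
  have hb := S.boundSymm_nonneg
  set ρ : ℝ → ℝ := fun ε => 1 + 2 * ε + R * ε with hρ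
  have key : ∀ ε > 0, a - ε - S.bound * ((S.boundSymm * (R' * ρ ε)) * (S.boundSymm * (2 * ε))
      + (S.boundSymm * (2 * ε)) ^ 2) ≤ (ρ ε) ^ 2 * aInfty S C := by
    intro ε hε
    obtain ⟨u, u', hu⟩ := h ε hε
    have hρ0 : 0 < ρ ε := by simp only [hρ]; positivity
    set θ : ℝ → StrongDual ℝ H := fun t => fderiv ℝ (gaugeHamiltonian C) (u t) with hθ
    have hθc : Continuous θ :=
      (hC.contDiff.continuous_fderiv one_ne_zero).comp hu.isLoop.continuous
    have hΩc : Continuous fun t => (2 * a) • S.Omega (u' t) :=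
      (S.Omega.continuous.comp hu.isLoop.continuous_deriv).const_smul (2 * a)
    set d : ℝ → StrongDual ℝ H := fun t => (2 * a) • S.Omega (u' t) + θ t with hd
    have hdc : Continuous d := hΩc.add hθc
    have hdε : l2Norm d ≤ ε := hu.defect
    set p : StrongDual ℝ H := ∫ t in (0 : ℝ)..1, θ t with hp
    have hpε : ‖p‖ ≤ ε := by
      have h1 : ∫ t in (0 : ℝ)..1, (2 * a) • S.Omega (u' t) = 0 :=
        ((hu.isLoop.map (S.Omega : H →L[ℝ] StrongDual ℝ H)).const_smul (2 * a)).integral_deriv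
      have h2 : p = ∫ t in (0 : ℝ)..1, d t := by
        rw [hd, intervalIntegral.integral_add (hΩc.intervalIntegrable _ _)
          (hθc.intervalIntegrable _ _), h1, zero_add]
      rw [h2]
      exact (intervalIntegral.norm_integral_le_integral_norm zero_le_one).trans
        ((integral_norm_le_l2Norm hdc).trans hdε)
    have hgauge : ∀ t, gauge (polarSet C) (θ t - p) ≤ ρ ε := fun t => by
      have h1 : gauge (polarSet C) (θ t) ≤ gauge C (u t) :=
        gauge_polarSet_le (gauge_nonneg _) fun x hx =>
          (fderiv_gaugeHamiltonian_le hC.convex hC.mem_nhds (hdiff _) x).trans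
            (mul_le_of_le_one_right (gauge_nonneg _) (gauge_le_one_of_mem hx))
      have h2 : gauge C (u t) ≤ 1 + 2 * ε := by
        have := (abs_le.1 (hu.energy t)).2
        unfold gaugeHamiltonian at this
        refine abs_le_of_sq_le_sq' ?_ (by positivity) |>.2
        nlinarith
      have h3 : gauge (polarSet C) (-p) ≤ R * ε := by
        refine (hR _).trans ?_
        rw [norm_neg]
        exact mul_le_mul_of_nonneg_left hpε hR0.le
      rw [sub_eq_add_neg]
      refine (gauge_add_le (convex_polarSet C) (absorbent_nhds_zero hC.polarSet_mem_nhds) _ _).trans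
        ?_
      simp only [hρ]
      linarith
    set v : ℝ → H := fun t => S.Omega.symm (θ t - p) with hv
    have hθpc : Continuous fun t => θ t - p := hθc.sub continuous_const
    have hvc : Continuous v := S.Omega.symm.continuous.comp hθpc
    have hvp : Function.Periodic v 1 := fun t => by simp only [hv, hθ, hu.isLoop.periodic t]
    have hv0 : ∫ t in (0 : ℝ)..1, v t = 0 := by
      have h1 : ∫ t in (0 : ℝ)..1, (θ t - p) = 0 := by
        rw [intervalIntegral.integral_sub (hθc.intervalIntegrable _ _) intervalIntegrable_const]
        simp [hp]
      have h2 := (S.Omega.symm : StrongDual ℝ H →L[ℝ] H).intervalIntegral_comp_comm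
        (hθpc.intervalIntegrable (μ := MeasureTheory.volume) 0 1)
      rw [h1, map_zero] at h2
      exact h2
    have hζ := IsLoop.of_integral_eq_zero hvc hvp hv0
    set ζ : ℝ → H := fun t => ∫ s in (0 : ℝ)..t, v s with hζdef
    have hy := hu.isLoop.const_smul (-(2 * a))
    have hq := hy.add (hζ.const_smul (-1))
    have hqv : ∀ t, -(2 * a) • u' t + (-1 : ℝ) • v t = -S.Omega.symm (d t - p) := fun t => by
      simp only [hv, hd, map_sub, map_add, map_smul, ContinuousLinearEquiv.symm_apply_apply,
        neg_smul, one_smul]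
      abel
    have hvl2 : l2Norm v ≤ S.boundSymm * (R' * ρ ε) :=
      l2Norm_le_of_norm_le hvc (by positivity) fun t _ =>
        (S.norm_Omega_symm_le _).trans (mul_le_mul_of_nonneg_left
          ((hR' _).trans (mul_le_mul_of_nonneg_left (hgauge t) hR'0.le)) hb)
    have hql2 : l2Norm (fun t => -(2 * a) • u' t + (-1 : ℝ) • v t) ≤ S.boundSymm * (2 * ε) := by
      have hdp : Continuous fun t => d t + -p := hdc.add continuous_const
      refine (l2Norm_le_mul hq.continuous_deriv hdp hb fun t _ => ?_).trans
        (mul_le_mul_of_nonneg_left ?_ hb)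
      · rw [hqv, norm_neg, sub_eq_add_neg]
        exact S.norm_Omega_symm_le _
      · refine (l2Norm_add_le hdc continuous_const).trans ?_
        have : l2Norm (fun _ : ℝ => -p) ≤ ε :=
          l2Norm_le_of_norm_le continuous_const hε.le fun t _ => by rwa [norm_neg]
        linarith
    have hact := S.abs_loopAction_add_sub_le hζ hq
    have hy1 : (fun t => ζ t + (-(2 * a) • u t + (-1 : ℝ) • ζ t)) = fun t => -(2 * a) • u t := by
      funext t; rw [neg_one_smul]; abel
    have hy2 : (fun t => v t + (-(2 * a) • u' t + (-1 : ℝ) • v t)) = fun t => -(2 * a) • u' t := by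
      funext t; rw [neg_one_smul]; abel
    rw [hy1, hy2, S.loopAction_smul, neg_sq] at hact
    have hact2 := (abs_le.1 hact).2
    have hact3 : S.bound * (l2Norm v * l2Norm (fun t => -(2 * a) • u' t + (-1 : ℝ) • v t)
        + l2Norm (fun t => -(2 * a) • u' t + (-1 : ℝ) • v t) ^ 2)
        ≤ S.bound * ((S.boundSymm * (R' * ρ ε)) * (S.boundSymm * (2 * ε))
          + (S.boundSymm * (2 * ε)) ^ 2) :=
      mul_le_mul_of_nonneg_left (add_le_add (mul_le_mul hvl2 hql2 (l2Norm_nonneg _)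
        (by positivity)) (pow_le_pow_left₀ (l2Norm_nonneg _) hql2 2)) S.bound_nonneg
    obtain ⟨h1, h2⟩ := IsPolarLoop.of_isLoop (C := C) S (hζ.const_smul (ρ ε)⁻¹) fun t => by
      refine hC.mem_polarSet ?_
      rw [map_smul, gauge_smul_of_nonneg (by positivity), smul_eq_mul, inv_mul_le_iff₀ hρ0, mul_one]
      simpa [hv] using hgauge t
    have h3 := S.dualAction_le_aInfty hC.toIsConvexNhd h1
    rw [h2, S.loopAction_smul, inv_pow, inv_mul_le_iff₀ (by positivity)] at h3
    linarith [hu.action]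
  have l1 : Filter.Tendsto (fun ε => a - ε - S.bound * ((S.boundSymm * (R' * ρ ε))
      * (S.boundSymm * (2 * ε)) + (S.boundSymm * (2 * ε)) ^ 2)) (𝓝[>] 0) (𝓝 a) :=
    (Continuous.tendsto' (by fun_prop) 0 a (by simp)).mono_left nhdsWithin_le_nhds
  have l2 : Filter.Tendsto (fun ε => (ρ ε) ^ 2 * aInfty S C) (𝓝[>] 0) (𝓝 (aInfty S C)) :=
    (Continuous.tendsto' (by fun_prop) 0 _ (by simp [hρ])).mono_left nhdsWithin_le_nhds
  refine le_of_tendsto_of_tendsto l1 l2 ?_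
  filter_upwards [self_mem_nhdsWithin] with ε hε using key ε hε

theorem aInfty_le_aInfty_image {ψ : H ≃ H} (hψ : IsHomogeneousSymplectomorphism S ψ)
    (hbound : ∃ M : ℝ, ∀ x : H, x ≠ 0 → ‖fderiv ℝ ψ.symm x‖ ≤ M)
    (hC : IsRegularConvexNhd C) (hψC : IsRegularConvexNhd (ψ '' C)) :
    aInfty S C ≤ aInfty S (ψ '' C) := by
  refine (S.aInfty_le_maxAction hC.toIsConvexNhd).trans ?_
  rcases le_or_gt (S.maxAction C) 0 with h0 | h0
  · exact h0.trans (S.aInfty_nonneg hψC.toIsConvexNhd)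
  obtain ⟨M, hM⟩ := hbound
  refine S.le_aInfty_of_isApproxCharacteristic hψC fun ε hε => ?_
  have hM1 : 1 ≤ max M 1 := le_max_right _ _
  have hM0 : 0 < max M 1 := zero_lt_one.trans_le hM1
  obtain ⟨u, u', hu⟩ := S.exists_isApproxCharacteristic hC h0
    (lt_min (by norm_num : (0 : ℝ) < 1 / 4) (div_pos hε hM0))
  have hz := hψ.isApproxCharacteristic_image hM1 (fun x hx => (hM x hx).trans (le_max_left _ _))
    hC hψC ((min_le_left _ _).trans_lt (by norm_num)) hu
  have hle : max M 1 * min (1 / 4) (ε / max M 1) ≤ ε :=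
    (mul_le_mul_of_nonneg_left (min_le_right _ _) hM0.le).trans_eq (mul_div_cancel₀ _ hM0.ne')
  exact ⟨_, _, hz.isLoop, hz.defect.trans hle, fun t => (hz.energy t).trans hle,
    by linarith [hz.action]⟩

end SymplecticStructure

theorem mainTheorem4 {H : Type*} [NormedAddCommGroup H] [InnerProductSpace ℝ H] [CompleteSpace H]
    (S : SymplecticStructure H) (ψ : H ≃ H) (hψ : IsHomogeneousSymplectomorphism S ψ)
    (hbound : ∃ M : ℝ, ∀ x : H, x ≠ 0 → ‖fderiv ℝ ψ x‖ ≤ M)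
    (hbound_symm : ∃ M : ℝ, ∀ x : H, x ≠ 0 → ‖fderiv ℝ ψ.symm x‖ ≤ M)
    (C : Set H) (hC : IsRegularConvexNhd C) (hψC : IsRegularConvexNhd (ψ '' C)) :
    symplecticCapacity S (ψ '' C) = symplecticCapacity S C := by
  have hinv : ψ.symm '' (ψ '' C) = C := by simp
  have h1 := S.aInfty_le_aInfty_image hψ hbound_symm hC hψC
  have h2 := S.aInfty_le_aInfty_image hψ.symm hbound hψC (by rwa [hinv])
  rw [hinv] at h2
  unfold symplecticCapacity
  rw [le_antisymm h2 h1]
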